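/- Let $n\ge 3$ and $m\ge 4$ be integers, let $w_0,\dots,w_{n-1}\ge 0$ be real numbers, and put $w=\sum_{i=0}^{n-1}w_i$. Let $G$ be the weighted digraph consisting of an undirected cycle on nodes $0,\dots,n-1$ and an undirected star with $m$ nodes (node $0$ of the star is the hub, nodes $1,\dots,m-1$ are the leaves), all of whose edges have weight $1$, together with, for each $0\le i\le n-1$, a directed edge of weight $w_i$ from cycle node $i$ to the hub. For $\overline\delta=(\delta_0,\dots,\delta_{m-1})$ with all $\delta_j\ge 0$, let $G_p$ be obtained from $G$ by adding, for each $0\le j\le m-1$, a directed edge of weight $\delta_j$ from star node $j$ to cycle node $0$, and put $\delta=\sum_{j=0}^{m-1}\delta_j$. The Laplacian of a weighted digraph is $L=D-A$, where $A_{ij}$ is the weight of the edge from $j$ to $i$ and $D$ is the diagonal matrix with $D_{ii}=\sum_j A_{ij}$. Its eigenvalues are listed with algebraic multiplicity so that $\mathrm{Re}\,\lambda_1\le\mathrm{Re}\,\lambda_2\le\cdots$; $\lambda_2$ is called the spectral gap. Put $$\alpha_l=2\Bigl(1-\cos\frac{l\pi}{n}\Bigr)\quad(0\le l\le n),\qquad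 \beta^-_{m,w}=\tfrac12\Bigl[m+w-\sqrt{(m+w)^2-4w}\Bigr],$$ $$S=\delta-\frac{\delta-\delta_0\alpha_2}{\alpha_2^2-(m+w)\alpha_2+w}\sum_{i=0}^{n-1}w_i\cos\frac{2i\pi}{n},\qquad \theta=\pi-\cos^{-1}\Bigl(\frac{\beta^-_{m,w}-2}{2}\Bigr).$$ Assume $\beta^-_{m,w}\notin\{\alpha_l: 0\le l\le n\}$. Then all eigenvalues of $L_G$ are real, and the following hold. (i) (Local modification) There is $\varepsilon>0$, depending only on $n$, $m$ and $(w_0,\dots,w_{n-1})$, such that for every $\overline\delta\ne 0$ with $0\le\delta_j<\varepsilon$ for all $j$, all eigenvalues of $L_{G_p}$ are real, and (a) if $\alpha_2<\beta^-_{m,w}$ and $S<0$, then $\lambda_2(L_{G_p})<\lambda_2(L_G)$; (b) if $\alpha_2<\beta^-_{m,w}$ and $S>0$, then $\lambda_2(L_{G_p})=\lambda_2(L_G)$; (c) if $0<\beta^-_{m,w}<\alpha_1$, then $\lambda_2(L_{G_p})>\lambda_2(L_G)$; (d) if $\alpha_1<\beta^-_{m,w}<\alpha_2$ and $\sum_{i=0}^{n-1}w_i\cos\bigl((\tfrac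 n2-i)\theta\bigr)>0$, then $\lambda_2(L_{G_p})>\lambda_2(L_G)$; (e) if $\alpha_1<\beta^-_{m,w}<\alpha_2$ and $\sum_{i=0}^{n-1}w_i\cos\bigl((\tfrac n2-i)\theta\bigr)<0$, then $\lambda_2(L_{G_p})<\lambda_2(L_G)$. (ii) (Global modification) Assume $\alpha_2<\beta^-_{m,w}$ and let $\overline\delta\ne0$ with all $\delta_j\ge0$ be arbitrary. (a) If $S<0$, then $\mathrm{Re}\,\lambda_2(L_{G_p})<\lambda_2(L_G)$. (b) If $S>0$, then $\mathrm{Re}\,\lambda_2(L_{G_p})\le\lambda_2(L_G)$. -/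

import Mathlib

noncomputable section

/-- Laplacian `D - A` of the weighted digraph with adjacency matrix `A`, where `A i j` is the weight
of the edge from `j` to `i` and `D` is the diagonal matrix of in-degrees. -/
def digraphLaplacian {V : Type*} [Fintype V] [DecidableEq V] (A : Matrix V V ℝ) : Matrix V V ℝ :=
  Matrix.diagonal (fun i => ∑ j, A i j) - A

/-- Complex eigenvalues of a real matrix, with algebraic multiplicity. -/
def complexEigenvalues {V : Type*} [Fintype V] [DecidableEq V] (M : Matrix V V ℝ) : Multiset ℂ :=
  (M.map (fun x : ℝ => (x : ℂ))).charpoly.roots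

/-- All eigenvalues of the real matrix `M` are real. -/
def HasRealSpectrum {V : Type*} [Fintype V] [DecidableEq V] (M : Matrix V V ℝ) : Prop :=
  ∀ z ∈ complexEigenvalues M, z.im = 0

/-- `Re λ₂(M)`: the eigenvalues are listed with algebraic multiplicity in nondecreasing order of
their real parts, `Re λ₁ ≤ Re λ₂ ≤ ⋯`, and the second real part is returned (list positions start
at `0`). It equals `λ₂(M)` when all eigenvalues are real. The default value `0` is used only for
matrices of size less than two. -/
def reLambda2 {V : Type*} [Fintype V] [DecidableEq V] (M : Matrix V V ℝ) : ℝ :=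
  (((complexEigenvalues M).map Complex.re).sort (· ≤ ·)).getD 1 0

/-- Adjacency matrix of the undirected star on `m` nodes with hub `0`, all weights equal to one. -/
def starAdj (m : ℕ) : Matrix (Fin m) (Fin m) ℝ :=
  Matrix.of fun i j => if i ≠ j ∧ ((i : ℕ) = 0 ∨ (j : ℕ) = 0) then 1 else 0

/-- Adjacency matrix of the cycle-star network. `Sum.inl i` are the nodes of the undirected cycle
and `Sum.inr j` those of the undirected star. There is an edge of weight `w i` from cycle node `i`
to the hub of the star, and an edge of weight `d j` from star node `j` to cycle node `0`. -/
def cycleStarAdj (n m : ℕ) (w : Fin n → ℝ) (d : Fin m → ℝ) :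
    Matrix (Fin n ⊕ Fin m) (Fin n ⊕ Fin m) ℝ :=
  Matrix.fromBlocks
    ((SimpleGraph.cycleGraph n).adjMatrix ℝ)
    (Matrix.of fun i j => if (i : ℕ) = 0 then d j else 0)
    (Matrix.of fun j i => if (j : ℕ) = 0 then w i else 0)
    (starAdj m)

/-- Laplacian of the modified network; `d = 0` is the unmodified one. -/
def cycleStarLaplacian (n m : ℕ) (w : Fin n → ℝ) (d : Fin m → ℝ) :
    Matrix (Fin n ⊕ Fin m) (Fin n ⊕ Fin m) ℝ :=
  digraphLaplacian (cycleStarAdj n m w d)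

/-- `α_l = 2 (1 - cos (l π / n))`. -/
def alphaVal (n l : ℕ) : ℝ := 2 * (1 - Real.cos (l * Real.pi / n))

/-- `β⁻_{m,w}`, the smaller root of `x² - (m + w) x + w`. -/
def betaMinus (m : ℕ) (w : ℝ) : ℝ := ((m + w) - √((m + w) ^ 2 - 4 * w)) / 2

/-- The quantity `S(m, n, w, δ₀, δ)`. -/
def gapSign (m n : ℕ) (w : Fin n → ℝ) (δ₀ δ : ℝ) : ℝ :=
  δ - (δ - δ₀ * alphaVal n 2) /
      (alphaVal n 2 ^ 2 - (m + ∑ i, w i) * alphaVal n 2 + ∑ i, w i) *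
    ∑ i : Fin n, w i * Real.cos (2 * ((i : ℕ) : ℝ) * Real.pi / n)

/-- `θ = π - arccos ((x - 2) / 2)`, the angle with `x = 2 (1 - cos θ)` when `0 ≤ x ≤ 4`. -/
def thetaOf (x : ℝ) : ℝ := Real.pi - Real.arccos ((x - 2) / 2)

/-- `∑ w_i cos ((n / 2 - i) θ)`. -/
def cosineSum (n : ℕ) (w : Fin n → ℝ) (θ : ℝ) : ℝ :=
  ∑ i : Fin n, w i * Real.cos (((n : ℝ) / 2 - ((i : ℕ) : ℝ)) * θ)

end

/-! All modifying edges enter the same cycle node, so they change a single row of the Laplacian.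
Hence `x - L` is a block triangular matrix, with cycle block `x - C` and star block `x - T`, plus a
rank one matrix (`scalar_sub_cycleStarLaplacian`). Away from finitely many `x`, its determinant is
`det (x - C) * det (x - T)` times the scalar `secular`, which is built from the Green function of
the cycle. The Fourier transform diagonalises `C` with eigenvalues `α_{2k}`, where `k` and `n - k`
give the same value; the star contributes `1` with multiplicity `m - 2` and the roots `β⁻`, `β⁺` of
`hubQuad`.

Clearing denominators (`charpoly_cycleStarLaplacian`) shows that the repeated copies of the `α_{2k}`
and the power of `x - 1` survive every modification. All movement happens in the monic polynomial
`secularPoly`. Its unperturbed roots are the distinct `α_{2l}` together with `β⁻` and `β⁺`; they are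
simple by the hypothesis on `β⁻` and because `β⁺ > m ≥ 4`.

Local part: simple real roots are detected by sign changes, which persist for small `d`, so the
roots stay real and close to the old ones (`exists_secularPoly_roots`). The sign of the perturbed
polynomial at an old root tells to which side that root moved (`root_side`). At `α₂` this sign is
governed by `S`. At `β⁻` it is governed by the cosine sum, through the closed form
`cycleGreen_eq_cos`; if `β⁻ < α₁`, all cosines in that sum are positive.

Global part: `0` and `α₂` (the latter through the repeated frequency `n - 1`) are eigenvalues for
every `d`, so `Re λ₂ ≤ α₂` always. If `S < 0`, the function `(α₂ - x) * secular`, continued to `[0,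
α₂]`, is positive at `0` and a positive multiple of `S` at `α₂`; this yields an eigenvalue strictly
between them (`exists_root_of_gapSign_neg`), with no smallness assumption. -/

noncomputable section

open Matrix Finset

/-! ### Fourier analysis and Green function of the cycle -/

/-- The adjacency matrix of the cycle acts on a function that is compatible with the wrap-around as
the sum of the two neighbouring values. -/
lemma cycleGraph_adjMatrix_mulVec {R : Type*} [CommRing R] {n : ℕ} (hn : 3 ≤ n) (f : ℤ → R)
    (h0 : f (-1) = f (n - 1)) (h1 : f n = f 0) (i : Fin n) :
    ((SimpleGraph.cycleGraph n).adjMatrix R *ᵥ fun j : Fin n => f (j : ℕ)) i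
      = f ((i : ℕ) - 1) + f ((i : ℕ) + 1) := by
  obtain ⟨k, rfl⟩ : ∃ k, n = k + 3 := ⟨n - 3, by omega⟩
  rw [SimpleGraph.adjMatrix_mulVec_apply, SimpleGraph.cycleGraph_neighborFinset]
  -- The two neighbours are distinct because `2 ≠ 0` modulo `n ≥ 3`.
  have hne : i - 1 ≠ i + 1 := by
    intro h
    have h2 : (i - 1 : Fin (k + 3)) + 1 = i + 1 + 1 := by rw [h]
    rw [sub_add_cancel, add_assoc, left_eq_add] at h2
    have h3 := congrArg Fin.val h2
    simp [Fin.val_add, Nat.mod_eq_of_lt] at h3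
  rw [Finset.sum_pair hne]
  congr 1
  · by_cases hi : i = 0
    · subst hi
      have : ((0 - 1 : Fin (k + 3)) : ℕ) = k + 2 := by
        simp
      rw [this]
      simp only [Fin.val_zero, Nat.cast_zero, zero_sub]
      rw [h0]; congr 1; push_cast; ring
    · have : ((i - 1 : Fin (k + 3)) : ℕ) = (i : ℕ) - 1 := Fin.val_sub_one_of_ne_zero hi
      have hpos : 1 ≤ (i : ℕ) := Nat.one_le_iff_ne_zero.2 (fun h => hi (Fin.ext h))
      rw [this]; push_cast [Nat.cast_sub hpos]; rfl
  · by_cases hi : i = Fin.last (k + 2)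
    · subst hi
      have : ((Fin.last (k + 2) + 1 : Fin (k + 3)) : ℕ) = 0 := by simp
      rw [this]
      simp only [Nat.cast_zero, Fin.val_last]
      rw [← h1]; congr 1
    · have : ((i + 1 : Fin (k + 3)) : ℕ) = (i : ℕ) + 1 :=
        Fin.val_add_one_of_lt (lt_of_le_of_ne (Fin.le_last i) hi)
      rw [this]; push_cast; rfl

lemma cycleGraph_adjMatrix_row_sum {R : Type*} [CommRing R] {n : ℕ} (hn : 3 ≤ n) (i : Fin n) :
    ∑ j, (SimpleGraph.cycleGraph n).adjMatrix R i j = 2 := by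
  have := cycleGraph_adjMatrix_mulVec hn (fun _ => (1 : R)) rfl rfl i
  simp only [mulVec, dotProduct, mul_one] at this
  rw [this]; norm_num

/-- The matrix `x - C`, where `C` is the Laplacian of the undirected cycle. -/
def cycleChar (R : Type*) [CommRing R] (n : ℕ) (x : R) : Matrix (Fin n) (Fin n) R :=
  (x - 2) • (1 : Matrix (Fin n) (Fin n) R) + (SimpleGraph.cycleGraph n).adjMatrix R

lemma cycleChar_mulVec {R : Type*} [CommRing R] {n : ℕ} (hn : 3 ≤ n) (x : R) (f : ℤ → R)
    (h0 : f (-1) = f (n - 1)) (h1 : f n = f 0) (i : Fin n) :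
    (cycleChar R n x *ᵥ fun j : Fin n => f (j : ℕ)) i
      = (x - 2) * f (i : ℕ) + (f ((i : ℕ) - 1) + f ((i : ℕ) + 1)) := by
  rw [cycleChar, add_mulVec, Pi.add_apply, cycleGraph_adjMatrix_mulVec hn f h0 h1, smul_mulVec,
    one_mulVec, Pi.smul_apply, smul_eq_mul]

lemma alphaVal_two_mul (n l : ℕ) :
    alphaVal n (2 * l) = 2 * (1 - Real.cos (2 * Real.pi * l / n)) := by
  unfold alphaVal
  congr 3
  push_cast; ring

/-- Sampled cosines of integer frequency wrap around the cycle, and `cos (a - b) + cos (a + b) = 2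
cos a cos b` makes them eigenvectors. -/
lemma cycleChar_mulVec_cos {n : ℕ} (hn : 3 ≤ n) (x : ℝ) (l : ℕ) (i : Fin n) :
    (cycleChar ℝ n x *ᵥ fun j : Fin n => Real.cos (2 * Real.pi * l * (j : ℕ) / n)) i
      = (x - alphaVal n (2 * l)) * Real.cos (2 * Real.pi * l * (i : ℕ) / n) := by
  have hn0 : (n : ℝ) ≠ 0 := by positivity
  have h := cycleChar_mulVec hn x (fun j : ℤ => Real.cos (2 * Real.pi * l * j / n))
    (by
      have : 2 * Real.pi * l * ((n - 1 : ℤ) : ℝ) / n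
          = 2 * Real.pi * l * ((-1 : ℤ) : ℝ) / n + l * (2 * Real.pi) := by
        push_cast; field_simp; ring
      simp only [this, Real.cos_add_nat_mul_two_pi])
    (by
      have : 2 * Real.pi * l * ((n : ℤ) : ℝ) / n
          = 2 * Real.pi * l * ((0 : ℤ) : ℝ) / n + l * (2 * Real.pi) := by
        push_cast; field_simp; ring
      simp only [this, Real.cos_add_nat_mul_two_pi]) i
  simp only [Int.cast_natCast, Int.cast_add, Int.cast_sub, Int.cast_one] at h
  rw [h, alphaVal_two_mul]
  have e1 : 2 * Real.pi * l * ((i : ℕ) - 1 : ℝ) / n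
      = 2 * Real.pi * l * (i : ℕ) / n - 2 * Real.pi * l / n := by ring
  have e2 : 2 * Real.pi * l * ((i : ℕ) + 1 : ℝ) / n
      = 2 * Real.pi * l * (i : ℕ) / n + 2 * Real.pi * l / n := by ring
  rw [e1, e2, Real.cos_sub, Real.cos_add]
  ring

/-- The primitive `n`-th root of unity `exp (2πi / n)`. -/
def rootUnity (n : ℕ) : ℂ := Complex.exp (2 * Real.pi * Complex.I / n)

lemma rootUnity_isPrimitiveRoot {n : ℕ} (hn : n ≠ 0) : IsPrimitiveRoot (rootUnity n) n :=
  Complex.isPrimitiveRoot_exp n hn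

lemma rootUnity_pow_re (n k : ℕ) : (rootUnity n ^ k).re = Real.cos (2 * Real.pi * k / n) := by
  rw [rootUnity, ← Complex.exp_nat_mul]
  have : (k : ℂ) * (2 * Real.pi * Complex.I / n)
      = ((2 * Real.pi * k / n : ℝ) : ℂ) * Complex.I := by push_cast; ring
  rw [this, Complex.exp_ofReal_mul_I_re]

lemma sum_cos_eq {n : ℕ} (i : Fin n) :
    ∑ k ∈ range n, Real.cos (2 * Real.pi * k * (i : ℕ) / n) = if (i : ℕ) = 0 then (n : ℝ) else 0 := by
  have hn : n ≠ 0 := by have := i.2; omega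
  have h : ∑ k ∈ range n, Real.cos (2 * Real.pi * k * (i : ℕ) / n)
      = (∑ k ∈ range n, (rootUnity n ^ (i : ℕ)) ^ k).re := by
    rw [Complex.re_sum]
    refine Finset.sum_congr rfl fun k _ => ?_
    rw [← pow_mul, rootUnity_pow_re]
    congr 1; push_cast; ring
  rw [h]
  split_ifs with hi
  · simp [hi]
  · have hne : rootUnity n ^ (i : ℕ) ≠ 1 :=
      (rootUnity_isPrimitiveRoot hn).pow_ne_one_of_pos_of_lt hi i.2
    rw [geom_sum_eq hne, ← pow_mul, mul_comm, pow_mul,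
      (rootUnity_isPrimitiveRoot hn).pow_eq_one]
    simp

lemma rootUnity_add_inv {n : ℕ} (k : ℕ) :
    rootUnity n ^ k + (rootUnity n ^ k)⁻¹ = 2 - (alphaVal n (2 * k) : ℂ) := by
  rw [alphaVal_two_mul, rootUnity, ← Complex.exp_nat_mul, ← Complex.exp_neg]
  have : (k : ℂ) * (2 * Real.pi * Complex.I / n)
      = ((2 * Real.pi * k / n : ℝ) : ℂ) * Complex.I := by push_cast; ring
  rw [this, ← neg_mul]
  push_cast
  rw [Complex.cos]
  ring

/-- The determinant of `x - C` is diagonalised by the discrete Fourier transform. -/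
lemma det_cycleChar {n : ℕ} (hn : 3 ≤ n) (x : ℝ) :
    (cycleChar ℝ n x).det = ∏ k ∈ range n, (x - alphaVal n (2 * k)) := by
  have hn0 : n ≠ 0 := by omega
  set ζ := rootUnity n with hζ
  have hprim := rootUnity_isPrimitiveRoot hn0
  have hζ0 : ζ ≠ 0 := hprim.ne_zero hn0
  -- The columns of `W` are the Fourier modes; as a Vandermonde matrix on distinct powers of `ζ` it
  -- is invertible.
  set W : Matrix (Fin n) (Fin n) ℂ := (vandermonde fun k : Fin n => ζ ^ (k : ℕ))ᵀ with hW
  have hWdet : W.det ≠ 0 := by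
    rw [hW, det_transpose, det_vandermonde_ne_zero_iff]
    intro a b hab
    exact Fin.ext (hprim.pow_inj a.2 b.2 hab)
  have hmul : cycleChar ℂ n x * W
      = W * diagonal fun k : Fin n => ((x - alphaVal n (2 * k) : ℝ) : ℂ) := by
    ext i k
    rw [mul_diagonal]
    have h := cycleChar_mulVec hn (x : ℂ) (fun j : ℤ => (ζ ^ (k : ℕ)) ^ j)
      (by
        have : (ζ ^ (k : ℕ)) ^ n = 1 := by rw [← pow_mul, mul_comm, pow_mul, hprim.pow_eq_one, one_pow]
        rw [zpow_sub₀ (pow_ne_zero _ hζ0), zpow_natCast, this]; simp)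
      (by
        have : (ζ ^ (k : ℕ)) ^ n = 1 := by rw [← pow_mul, mul_comm, pow_mul, hprim.pow_eq_one, one_pow]
        rw [zpow_natCast, this]; simp) i
    have h0 : (ζ ^ (k : ℕ)) ≠ 0 := pow_ne_zero _ hζ0
    simp only [zpow_natCast, zpow_sub₀ h0, zpow_add₀ h0, zpow_one] at h
    have h2 : (cycleChar ℂ n x * W) i k
        = (cycleChar ℂ n x *ᵥ fun j : Fin n => (ζ ^ (k : ℕ)) ^ (j : ℕ)) i := rfl
    have h3 : W i k = (ζ ^ (k : ℕ)) ^ (i : ℕ) := rfl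
    rw [h2, h, h3]
    have h4 := rootUnity_add_inv (n := n) k
    rw [← hζ] at h4
    have h5 : (alphaVal n (2 * k) : ℂ) = 2 - (ζ ^ (k : ℕ) + (ζ ^ (k : ℕ))⁻¹) := by rw [h4]; ring
    push_cast
    rw [h5]
    field_simp
    ring
  have hmap : (cycleChar ℝ n x).map (algebraMap ℝ ℂ) = cycleChar ℂ n x := by
    ext i j
    simp only [cycleChar, map_apply, Matrix.add_apply, Matrix.smul_apply, Matrix.one_apply, SimpleGraph.adjMatrix_apply,
      smul_eq_mul, map_add, map_mul, map_sub]
    split_ifs <;> simp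
  have hdet : (cycleChar ℂ n x).det = ∏ k : Fin n, ((x - alphaVal n (2 * k) : ℝ) : ℂ) := by
    have := congrArg Matrix.det hmul
    rw [det_mul, det_mul, det_diagonal, mul_comm] at this
    exact mul_left_cancel₀ hWdet this
  have h6 : (((cycleChar ℝ n x).det : ℝ) : ℂ)
      = ((∏ k : Fin n, (x - alphaVal n (2 * k)) : ℝ) : ℂ) := by
    rw [Complex.ofReal_prod, ← hdet, ← hmap]
    exact (RingHom.map_det (algebraMap ℝ ℂ) _)
  rw [Complex.ofReal_inj.1 h6, Finset.prod_range (fun k => x - alphaVal n (2 * k))]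


/-- Multiplicity, divided by `n`, of the `l`-th distinct eigenvalue of the cycle Laplacian. -/
def cycleWeight (n : ℕ) (l : Fin (n / 2 + 1)) : ℝ :=
  #{k ∈ range n | min k (n - k) = (l : ℕ)} / n

lemma cycleWeight_pos {n : ℕ} (hn : 3 ≤ n) (l : Fin (n / 2 + 1)) : 0 < cycleWeight n l := by
  have h : 0 < #{k ∈ range n | min k (n - k) = (l : ℕ)} := by
    refine Finset.card_pos.2 ⟨l, ?_⟩
    have := l.2
    simp only [Finset.mem_filter, Finset.mem_range]
    omega
  unfold cycleWeight
  positivity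

/-- Frequencies `k` and `n - k` agree on integer points, so only `0, …, n / 2` are needed to index
the distinct modes. -/
lemma cos_fold {n k : ℕ} (hk : k < n) (i : ℕ) :
    Real.cos (2 * Real.pi * k * i / n) = Real.cos (2 * Real.pi * (min k (n - k) : ℕ) * i / n) := by
  rcases le_total k (n - k) with h | h
  · rw [min_eq_left h]
  · rw [min_eq_right h, Nat.cast_sub hk.le]
    have hn : (n : ℝ) ≠ 0 := by
      have : n ≠ 0 := by omega
      exact_mod_cast this
    have : 2 * Real.pi * ((n : ℝ) - k) * i / n
        = i * (2 * Real.pi) - 2 * Real.pi * k * i / n := by field_simp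
    rw [this, Real.cos_nat_mul_two_pi_sub]

/-- This expands the point source at node `0` in cosine eigenvectors: group the full Fourier sum by
folded frequency. -/
lemma sum_cycleWeight_mul_cos {n : ℕ} (i : Fin n) :
    ∑ l : Fin (n / 2 + 1), cycleWeight n l * Real.cos (2 * Real.pi * (l : ℕ) * (i : ℕ) / n)
      = if (i : ℕ) = 0 then 1 else 0 := by
  have hn : (n : ℝ) ≠ 0 := by
    have : n ≠ 0 := by have := i.2; omega
    exact_mod_cast this
  have h : ∑ k ∈ range n, Real.cos (2 * Real.pi * k * (i : ℕ) / n)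
      = n * ∑ l : Fin (n / 2 + 1),
        cycleWeight n l * Real.cos (2 * Real.pi * (l : ℕ) * (i : ℕ) / n) := by
    rw [← Finset.sum_fiberwise_of_maps_to (g := fun k => min k (n - k)) (t := range (n / 2 + 1))
      (fun k hk => by simp only [Finset.mem_range] at *; omega), Finset.sum_range, Finset.mul_sum]
    refine Finset.sum_congr rfl fun l _ => ?_
    rw [Finset.sum_congr rfl (g := fun _ => Real.cos (2 * Real.pi * (l : ℕ) * (i : ℕ) / n)),
      Finset.sum_const, nsmul_eq_mul, cycleWeight]
    · field_simp
    · intro k hk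
      simp only [Finset.mem_filter, Finset.mem_range] at hk
      rw [cos_fold hk.1, hk.2]
  rw [sum_cos_eq] at h
  have h2 : ∑ l : Fin (n / 2 + 1),
      cycleWeight n l * Real.cos (2 * Real.pi * (l : ℕ) * (i : ℕ) / n)
      = (if (i : ℕ) = 0 then (n : ℝ) else 0) / n := by rw [h, mul_div_cancel_left₀ _ hn]
  rw [h2]
  split_ifs <;> simp [hn]

/-- The solution of `(x - C) u = e₀`, with `C` the Laplacian of the undirected cycle. -/
def cycleGreen (n : ℕ) (x : ℝ) (i : Fin n) : ℝ :=
  ∑ l : Fin (n / 2 + 1), cycleWeight n l * Real.cos (2 * Real.pi * (l : ℕ) * (i : ℕ) / n)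
    / (x - alphaVal n (2 * l))

lemma cycleChar_mulVec_cycleGreen {n : ℕ} (hn : 3 ≤ n) {x : ℝ}
    (hx : ∀ l : Fin (n / 2 + 1), x ≠ alphaVal n (2 * l)) :
    cycleChar ℝ n x *ᵥ cycleGreen n x = fun i : Fin n => if (i : ℕ) = 0 then (1 : ℝ) else 0 := by
  have h : cycleGreen n x = ∑ l : Fin (n / 2 + 1), (cycleWeight n l / (x - alphaVal n (2 * l))) •
      fun i : Fin n => Real.cos (2 * Real.pi * (l : ℕ) * (i : ℕ) / n) := by
    ext i
    simp only [cycleGreen, Finset.sum_apply, Pi.smul_apply, smul_eq_mul]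
    exact Finset.sum_congr rfl fun l _ => by ring
  rw [h, mulVec_sum]
  ext i
  rw [Finset.sum_apply, ← sum_cycleWeight_mul_cos]
  refine Finset.sum_congr rfl fun l _ => ?_
  rw [mulVec_smul, Pi.smul_apply, cycleChar_mulVec_cos hn, smul_eq_mul]
  have := sub_ne_zero.2 (hx l)
  field_simp

lemma det_cycleChar_ne_zero {n : ℕ} (hn : 3 ≤ n) {x : ℝ}
    (hx : ∀ l : Fin (n / 2 + 1), x ≠ alphaVal n (2 * l)) : (cycleChar ℝ n x).det ≠ 0 := by
  rw [det_cycleChar hn, Finset.prod_ne_zero_iff]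
  intro k hk
  rw [Finset.mem_range] at hk
  have h := hx ⟨min k (n - k), by omega⟩
  rw [alphaVal_two_mul] at h ⊢
  have h2 := cos_fold hk 1
  simp only [Nat.cast_one, mul_one] at h2
  rw [h2]
  exact sub_ne_zero.2 h

/-- Closed form of the Green function of the cycle. -/
lemma cycleGreen_eq_cos {n : ℕ} (hn : 3 ≤ n) {x θ : ℝ}
    (hx : ∀ l : Fin (n / 2 + 1), x ≠ alphaVal n (2 * l)) (hθ : x = 2 * (1 - Real.cos θ))
    (hsin : Real.sin θ * Real.sin (n / 2 * θ) ≠ 0) (i : Fin n) :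
    cycleGreen n x i
      = Real.cos (((n : ℝ) / 2 - (i : ℕ)) * θ) / (2 * (Real.sin θ * Real.sin (n / 2 * θ))) := by
  set ν : Fin n → ℝ := fun i => Real.cos (((n : ℝ) / 2 - (i : ℕ)) * θ) with hν
  have hval : cycleChar ℝ n x *ᵥ ν
      = (2 * (Real.sin θ * Real.sin (n / 2 * θ))) • fun i : Fin n => if (i : ℕ) = 0 then (1 : ℝ) else 0 := by
    ext i
    -- The absolute value makes the function match at `-1` and `n - 1`, without changing it on the
    -- nodes. The kink it creates at `0` is the point source of strength `2 sin θ sin (n θ / 2)`.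
    have h := cycleChar_mulVec hn x (fun j : ℤ => Real.cos (((n : ℝ) / 2 - |(j : ℝ)|) * θ))
      (by
        have h1 : |((n - 1 : ℤ) : ℝ)| = n - 1 := by
          push_cast
          rw [abs_of_nonneg]
          have : (3 : ℝ) ≤ n := by exact_mod_cast hn
          linarith
        simp only [h1]
        rw [← Real.cos_neg]
        congr 1
        push_cast
        rw [abs_neg, abs_one]
        ring)
      (by
        simp only [Int.cast_natCast, Nat.abs_cast, Int.cast_zero, abs_zero]
        rw [← Real.cos_neg]
        congr 1
        ring) i
    simp only [Int.cast_natCast, Nat.abs_cast] at h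
    rw [hν, h, Pi.smul_apply, smul_eq_mul, hθ]
    split_ifs with hi
    · rw [hi]
      push_cast
      simp only [abs_neg, abs_one, sub_zero]
      have e : ((n : ℝ) / 2 - 1) * θ = n / 2 * θ - θ := by ring
      rw [e, Real.cos_sub]
      ring
    · have hi1 : (1 : ℝ) ≤ (i : ℕ) := by exact_mod_cast Nat.one_le_iff_ne_zero.2 hi
      push_cast
      rw [abs_of_nonneg (by linarith), abs_of_nonneg (by linarith)]
      have e1 : ((n : ℝ) / 2 - ((i : ℕ) - 1)) * θ = ((n : ℝ) / 2 - (i : ℕ)) * θ + θ := by ring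
      have e2 : ((n : ℝ) / 2 - ((i : ℕ) + 1)) * θ = ((n : ℝ) / 2 - (i : ℕ)) * θ - θ := by ring
      rw [e1, e2, Real.cos_add, Real.cos_sub]
      ring
  have hzero : cycleChar ℝ n x *ᵥ
      ((2 * (Real.sin θ * Real.sin (n / 2 * θ))) • cycleGreen n x - ν) = 0 := by
    rw [mulVec_sub, mulVec_smul, cycleChar_mulVec_cycleGreen hn hx, hval, sub_self]
  have h0 := congrFun (eq_zero_of_mulVec_eq_zero (det_cycleChar_ne_zero hn hx) hzero) i
  simp only [Pi.sub_apply, Pi.smul_apply, smul_eq_mul, Pi.zero_apply, hν] at h0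
  rw [eq_div_iff (by positivity)]
  linarith

/-! ### Ordering of the cycle eigenvalues -/

lemma alphaVal_lt_alphaVal {n k l : ℕ} (hkl : k < l) (hl : l ≤ n) : alphaVal n k < alphaVal n l := by
  have hn : (0 : ℝ) < n := by
    have : 0 < n := by omega
    exact_mod_cast this
  have h : Real.cos (l * Real.pi / n) < Real.cos (k * Real.pi / n) := by
    have hkl' : (k : ℝ) < l := by exact_mod_cast hkl
    have hl' : (l : ℝ) ≤ n := by exact_mod_cast hl
    refine Real.cos_lt_cos_of_nonneg_of_le_pi (by positivity) ?_ ?_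
    · rw [div_le_iff₀ hn, mul_comm]
      exact mul_le_mul_of_nonneg_left hl' Real.pi_pos.le
    · gcongr
  unfold alphaVal
  linarith

lemma alphaVal_zero (n : ℕ) : alphaVal n 0 = 0 := by simp [alphaVal]

lemma alphaVal_le_four (n l : ℕ) : alphaVal n l ≤ 4 := by
  unfold alphaVal
  linarith [Real.neg_one_le_cos (l * Real.pi / n)]

lemma alphaVal_fold {n k : ℕ} (hk : k < n) : alphaVal n (2 * k) = alphaVal n (2 * min k (n - k)) := by
  have h2 := cos_fold hk 1
  simp only [Nat.cast_one, mul_one] at h2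
  rw [alphaVal_two_mul, alphaVal_two_mul, h2]

lemma alphaVal_two_le {n k : ℕ} (hk : k < n) (hk0 : k ≠ 0) : alphaVal n 2 ≤ alphaVal n (2 * k) := by
  rw [alphaVal_fold hk]
  have h1 : 1 ≤ min k (n - k) := by omega
  rcases h1.eq_or_lt with h | h
  · rw [← h]
  · exact (alphaVal_lt_alphaVal (by omega) (by omega)).le

lemma alphaVal_two_mul_injective (n : ℕ) :
    Function.Injective fun l : Fin (n / 2 + 1) => alphaVal n (2 * l) := by
  refine StrictMono.injective fun a b hab => ?_
  have := b.2
  exact alphaVal_lt_alphaVal (by have : (a : ℕ) < b := hab; omega) (by omega)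

/-! ### The star block -/

/-- The matrix `x - T`, where `T` is the Laplacian of the star with `k` leaves whose hub has an
additional incoming weight `w`. -/
def starChar (k : ℕ) (w x : ℝ) : Matrix (Fin (k + 1)) (Fin (k + 1)) ℝ :=
  diagonal (fun j => if j = 0 then x - (k + w) else x - 1) + starAdj (k + 1)

/-- The quadratic `x² - (m + w) x + w`. -/
def hubQuad (m : ℕ) (w x : ℝ) : ℝ := x ^ 2 - (m + w) * x + w

lemma starAdj_apply_zero_zero (k : ℕ) : starAdj (k + 1) 0 0 = 0 := by simp [starAdj]

lemma starAdj_apply_zero_succ (k : ℕ) (j : Fin k) : starAdj (k + 1) 0 j.succ = 1 := by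
  simp [starAdj, (Fin.succ_ne_zero j).symm]

lemma starAdj_apply_succ_zero (k : ℕ) (j : Fin k) : starAdj (k + 1) j.succ 0 = 1 := by
  simp [starAdj]

lemma starAdj_apply_succ_succ (k : ℕ) (i j : Fin k) : starAdj (k + 1) i.succ j.succ = 0 := by
  simp [starAdj]

lemma starAdj_row_sum (k : ℕ) (j : Fin (k + 1)) :
    ∑ l, starAdj (k + 1) j l = if j = 0 then (k : ℝ) else 1 := by
  rw [Fin.sum_univ_succ]
  refine Fin.cases ?_ (fun i => ?_) j
  · simp [starAdj_apply_zero_zero, starAdj_apply_zero_succ]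
  · simp [starAdj_apply_succ_zero, starAdj_apply_succ_succ]

/-- Off the scalar matrix `x - 1`, only the row and the column of the hub are occupied. This is a
rank two update, so the determinant reduces to a `2 × 2` one; `x ≠ 1` allows division by `x - 1`. -/
lemma det_starChar_of_ne {k : ℕ} (hk : 1 ≤ k) (w : ℝ) {x : ℝ} (hx : x ≠ 1) :
    (starChar k w x).det = (x - 1) ^ (k - 1) * hubQuad (k + 1) w x := by
  have hx1 : x - 1 ≠ 0 := sub_ne_zero.2 hx
  set U : Matrix (Fin (k + 1)) (Fin 2) ℝ := of fun j => ![if j = 0 then 1 else 0, if j = 0 then 0 else 1]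
    with hU
  set W : Matrix (Fin 2) (Fin (k + 1)) ℝ := of ![fun j => (if j = 0 then 1 - k - w else 1) / (x - 1),
    fun j => (if j = 0 then 1 else 0) / (x - 1)] with hW
  have h : starChar k w x = (x - 1) • (1 + U * W) := by
    ext i j
    simp only [starChar, Matrix.add_apply, Matrix.smul_apply, mul_apply, Fin.sum_univ_two, hU, hW,
      of_apply, smul_eq_mul]
    refine Fin.cases ?_ (fun i' => ?_) i <;> refine Fin.cases ?_ (fun j' => ?_) j
    · simp [starAdj_apply_zero_zero]
      field_simp
      ring
    · simp [starAdj_apply_zero_succ, diagonal_apply_ne _ (Fin.succ_ne_zero j').symm,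
        Matrix.one_apply_ne (Fin.succ_ne_zero j').symm]
      field_simp
    · simp [starAdj_apply_succ_zero, Matrix.one_apply_ne (Fin.succ_ne_zero i')]
      field_simp
    · simp [starAdj_apply_succ_succ, diagonal_apply, Matrix.one_apply]
  rw [h, det_smul, det_one_add_mul_comm, det_fin_two]
  have e00 : (1 + W * U : Matrix (Fin 2) (Fin 2) ℝ) 0 0 = 1 + (1 - k - w) / (x - 1) := by
    rw [Matrix.add_apply, Matrix.mul_apply, Fin.sum_univ_succ]; simp [hU, hW]
  have e01 : (1 + W * U : Matrix (Fin 2) (Fin 2) ℝ) 0 1 = k / (x - 1) := by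
    rw [Matrix.add_apply, Matrix.mul_apply, Fin.sum_univ_succ]; simp [hU, hW, div_eq_mul_inv]
  have e10 : (1 + W * U : Matrix (Fin 2) (Fin 2) ℝ) 1 0 = 1 / (x - 1) := by
    rw [Matrix.add_apply, Matrix.mul_apply, Fin.sum_univ_succ]; simp [hU, hW]
  have e11 : (1 + W * U : Matrix (Fin 2) (Fin 2) ℝ) 1 1 = 1 := by
    rw [Matrix.add_apply, Matrix.mul_apply, Fin.sum_univ_succ]; simp [hU, hW]
  rw [e00, e01, e10, e11, Fintype.card_fin]
  obtain ⟨j, rfl⟩ : ∃ j, k = j + 1 := ⟨k - 1, by omega⟩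
  simp only [hubQuad, Nat.add_sub_cancel, pow_succ]
  push_cast
  field_simp
  ring

/-- The solution of `(T - x) v = e₀`, up to the factor `hubQuad`. -/
def starVec (k : ℕ) (x : ℝ) (j : Fin (k + 1)) : ℝ := if j = 0 then 1 - x else 1

lemma starChar_mulVec_starVec (k : ℕ) (w x : ℝ) :
    starChar k w x *ᵥ starVec k x = fun j => if j = 0 then -hubQuad (k + 1) w x else 0 := by
  ext j
  rw [starChar, add_mulVec, Pi.add_apply, mulVec_diagonal, mulVec, dotProduct, Fin.sum_univ_succ]
  refine Fin.cases ?_ (fun i => ?_) j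
  · simp [starVec, starAdj_apply_zero_zero, starAdj_apply_zero_succ, hubQuad]
    ring
  · simp [starVec, starAdj_apply_succ_zero, starAdj_apply_succ_succ]

lemma sum_mul_starVec (k : ℕ) (x : ℝ) (d : Fin (k + 1) → ℝ) :
    ∑ j, d j * starVec k x j = (∑ j, d j) - d 0 * x := by
  rw [Fin.sum_univ_succ, Fin.sum_univ_succ]
  simp [starVec]
  ring

/-! ### Rank one modification and the secular function -/

lemma scalar_sub_cycleStarLaplacian {n k : ℕ} (hn : 3 ≤ n) (w : Fin n → ℝ) (d : Fin (k + 1) → ℝ)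
    (x : ℝ) :
    Matrix.scalar _ x - cycleStarLaplacian n (k + 1) w d
      = fromBlocks (cycleChar ℝ n x) 0 (of fun (j : Fin (k + 1)) i => if (j : ℕ) = 0 then w i else 0)
          (starChar k (∑ i, w i) x)
        + vecMulVec (Sum.elim (fun i : Fin n => if (i : ℕ) = 0 then 1 else 0) 0)
          (Sum.elim (fun i : Fin n => if (i : ℕ) = 0 then -∑ j, d j else 0) d) := by
  ext (i | i) (j | j)
  · have hrow : ∑ s, cycleStarAdj n (k + 1) w d (Sum.inl i) s
        -- The in-degree of cycle node `0` grows by the total added weight; this is the source of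
        -- the entry `-∑ j, d j` in the rank one term.
        = 2 + if (i : ℕ) = 0 then ∑ j, d j else 0 := by
      rw [Fintype.sum_sum_type]
      simp only [cycleStarAdj, fromBlocks_apply₁₁, fromBlocks_apply₁₂, of_apply]
      rw [cycleGraph_adjMatrix_row_sum hn]
      split_ifs <;> simp
    simp only [cycleStarLaplacian, digraphLaplacian, Matrix.sub_apply, Matrix.add_apply,
      scalar_apply, diagonal_apply, Sum.inl.injEq, hrow]
    simp only [cycleStarAdj, cycleChar, fromBlocks_apply₁₁, vecMulVec_apply, Sum.elim_inl,
      Matrix.add_apply, Matrix.smul_apply, Matrix.one_apply, smul_eq_mul]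
    by_cases hij : i = j
    · subst hij
      by_cases hi : (i : ℕ) = 0
      · simp [hi]
        ring
      · simp [hi]
    · have : ¬ ((i : ℕ) = 0 ∧ (j : ℕ) = 0) := fun h => hij (Fin.ext (h.1.trans h.2.symm))
      by_cases hi : (i : ℕ) = 0
      · have hj : (j : ℕ) ≠ 0 := fun h => this ⟨hi, h⟩
        simp [hij, hi, hj]
      · simp [hij, hi]
  · simp [cycleStarLaplacian, digraphLaplacian, cycleStarAdj, vecMulVec_apply]
  · simp [cycleStarLaplacian, digraphLaplacian, cycleStarAdj, vecMulVec_apply]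
  · have hrow : ∑ s, cycleStarAdj n (k + 1) w d (Sum.inr i) s
        = if i = 0 then k + ∑ i, w i else 1 := by
      rw [Fintype.sum_sum_type]
      simp only [cycleStarAdj, fromBlocks_apply₂₁, fromBlocks_apply₂₂, of_apply, Fin.val_eq_zero_iff]
      rw [starAdj_row_sum]
      split_ifs <;> simp [add_comm]
    simp only [cycleStarLaplacian, digraphLaplacian, Matrix.sub_apply, Matrix.add_apply,
      scalar_apply, diagonal_apply, Sum.inr.injEq, hrow]
    simp only [cycleStarAdj, starChar, fromBlocks_apply₂₂, vecMulVec_apply, Sum.elim_inr,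
      Matrix.add_apply, diagonal_apply, Pi.zero_apply, zero_mul, add_zero]
    by_cases hij : i = j
    · simp only [hij, if_true]
      split_ifs <;> ring
    · simp [hij]

/-- The secular function of the rank one modification. -/
def secular (n m : ℕ) (w : Fin n → ℝ) (δ₀ δ x : ℝ) : ℝ :=
  1 - δ * ∑ l : Fin (n / 2 + 1), cycleWeight n l / (x - alphaVal n (2 * l))
    + (δ - δ₀ * x) / hubQuad m (∑ i, w i) x * ∑ i, w i * cycleGreen n x i

/-- Matrix determinant lemma: with `A y = e`, one has `det (A + e rᵀ) = det A * (1 + r ⬝ᵥ y)`. -/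
lemma eval_charpoly_cycleStarLaplacian {n k : ℕ} (hn : 3 ≤ n) (hk : 1 ≤ k) (w : Fin n → ℝ)
    (d : Fin (k + 1) → ℝ) {x : ℝ} (hx : ∀ l : Fin (n / 2 + 1), x ≠ alphaVal n (2 * l))
    (hx1 : x ≠ 1) (hq : hubQuad (k + 1) (∑ i, w i) x ≠ 0) :
    (cycleStarLaplacian n (k + 1) w d).charpoly.eval x
      = (∏ j ∈ range n, (x - alphaVal n (2 * j))) * ((x - 1) ^ (k - 1) * hubQuad (k + 1) (∑ i, w i) x)
        * secular n (k + 1) w (d 0) (∑ j, d j) x := by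
  set s := ∑ i, w i * cycleGreen n x i with hs
  set q := hubQuad (k + 1) (∑ i, w i) x with hqdef
  set A := fromBlocks (cycleChar ℝ n x) 0
    (of fun (j : Fin (k + 1)) i => if (j : ℕ) = 0 then w i else 0) (starChar k (∑ i, w i) x) with hA
  set e : Fin n ⊕ Fin (k + 1) → ℝ := Sum.elim (fun i : Fin n => if (i : ℕ) = 0 then 1 else 0) 0 with he
  set r : Fin n ⊕ Fin (k + 1) → ℝ :=
    Sum.elim (fun i : Fin n => if (i : ℕ) = 0 then -∑ j, d j else 0) d with hr
  -- Forward substitution: the cycle part is the Green function, and the factor `s / q` cancels the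
  -- inflow `s` that it sends to the hub.
  set y : Fin n ⊕ Fin (k + 1) → ℝ := Sum.elim (cycleGreen n x) ((s / q) • starVec k x) with hy
  have hAy : A *ᵥ y = e := by
    rw [hA, hy, fromBlocks_mulVec, he]
    congr 1
    · simp only [Sum.elim_comp_inl, Sum.elim_comp_inr, zero_mulVec, add_zero]
      exact cycleChar_mulVec_cycleGreen hn hx
    · simp only [Sum.elim_comp_inl, Sum.elim_comp_inr]
      rw [mulVec_smul, starChar_mulVec_starVec]
      ext j
      simp only [Pi.add_apply, Pi.smul_apply, Pi.zero_apply, mulVec, dotProduct, of_apply,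
        Fin.val_eq_zero_iff, smul_eq_mul]
      split_ifs
      · rw [← hs, ← hqdef]; field_simp; ring
      · simp
  have hfac : A + vecMulVec e r = A * (1 + replicateCol Unit y * replicateRow Unit r) := by
    rw [Matrix.mul_add, Matrix.mul_one, ← Matrix.mul_assoc, ← replicateCol_mulVec, hAy,
      vecMulVec_eq Unit e r]
  have hry : r ⬝ᵥ y = -(∑ j, d j) * ∑ l : Fin (n / 2 + 1), cycleWeight n l / (x - alphaVal n (2 * l))
      + ((∑ j, d j) - d 0 * x) / q * s := by
    rw [dotProduct, Fintype.sum_sum_type]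
    simp only [hr, hy, Sum.elim_inl, Sum.elim_inr, Pi.smul_apply, smul_eq_mul]
    congr 1
    · rw [Finset.sum_eq_single (⟨0, by omega⟩ : Fin n)]
      · simp [cycleGreen]
      · intro b _ hb
        rw [if_neg (fun h => hb (Fin.ext h)), zero_mul]
      · simp
    · rw [← sum_mul_starVec k x d, div_mul_eq_mul_div, mul_div_assoc, Finset.sum_mul]
      exact Finset.sum_congr rfl fun j _ => by ring
  rw [Matrix.eval_charpoly, scalar_sub_cycleStarLaplacian hn, ← hA, hfac, det_mul,
    det_one_add_replicateCol_mul_replicateRow, hry, hA, det_fromBlocks_zero₁₂, det_cycleChar hn,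
    det_starChar_of_ne hk _ hx1, secular]
  ring

/-! ### Clearing denominators: the characteristic polynomial -/

open Polynomial in
/-- The monic polynomial whose roots are the distinct eigenvalues of the cycle Laplacian. -/
def cycleDistinctPoly (n : ℕ) : ℝ[X] := ∏ l : Fin (n / 2 + 1), (X - C (alphaVal n (2 * l)))

open Polynomial in
/-- The monic polynomial whose roots are the repeated eigenvalues of the cycle Laplacian. -/
def cycleRepeatedPoly (n : ℕ) : ℝ[X] := ∏ k ∈ Ico (n / 2 + 1) n, (X - C (alphaVal n (2 * k)))

open Polynomial in
/-- `cycleGreen` with denominators cleared. -/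
def greenPoly (n j : ℕ) : ℝ[X] :=
  ∑ l : Fin (n / 2 + 1), C (cycleWeight n l * Real.cos (2 * Real.pi * (l : ℕ) * j / n))
    * ∏ l' ∈ univ.erase l, (X - C (alphaVal n (2 * l')))

open Polynomial in
/-- `hubQuad` as a polynomial. -/
def hubPoly (m : ℕ) (w : ℝ) : ℝ[X] := X ^ 2 - C (m + w) * X + C w

open Polynomial in
/-- `secular` with denominators cleared. -/
def secularPoly (n m : ℕ) (w : Fin n → ℝ) (δ₀ δ : ℝ) : ℝ[X] :=
  cycleDistinctPoly n * hubPoly m (∑ i, w i)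
    + ((C δ - C δ₀ * X) * ∑ i : Fin n, C (w i) * greenPoly n i
      - C δ * hubPoly m (∑ i, w i) * greenPoly n 0)

lemma eval_hubPoly (m : ℕ) (w x : ℝ) : (hubPoly m w).eval x = hubQuad m w x := by
  simp [hubPoly, hubQuad]

lemma eval_cycleDistinctPoly (n : ℕ) (x : ℝ) :
    (cycleDistinctPoly n).eval x = ∏ l : Fin (n / 2 + 1), (x - alphaVal n (2 * l)) := by
  simp [cycleDistinctPoly, Polynomial.eval_prod]

lemma eval_greenPoly (n j : ℕ) (x : ℝ) : (greenPoly n j).eval x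
    = ∑ l : Fin (n / 2 + 1), cycleWeight n l * Real.cos (2 * Real.pi * (l : ℕ) * j / n)
    * ∏ l' ∈ univ.erase l, (x - alphaVal n (2 * l')) := by
  simp [greenPoly, Polynomial.eval_prod, Polynomial.eval_finsetSum]

lemma eval_secularPoly (n m : ℕ) (w : Fin n → ℝ) (δ₀ δ x : ℝ) :
    (secularPoly n m w δ₀ δ).eval x
      = (cycleDistinctPoly n).eval x * hubQuad m (∑ i, w i) x
        + ((δ - δ₀ * x) * ∑ i : Fin n, w i * (greenPoly n i).eval x
          - δ * hubQuad m (∑ i, w i) x * (greenPoly n 0).eval x) := by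
  simp [secularPoly, Polynomial.eval_finsetSum, eval_hubPoly]

lemma eval_greenPoly_of_ne {n : ℕ} (j : ℕ) {x : ℝ}
    (hx : ∀ l : Fin (n / 2 + 1), x ≠ alphaVal n (2 * l)) : (greenPoly n j).eval x
    = (cycleDistinctPoly n).eval x * ∑ l : Fin (n / 2 + 1),
      cycleWeight n l * Real.cos (2 * Real.pi * (l : ℕ) * j / n) / (x - alphaVal n (2 * l)) := by
  rw [eval_greenPoly, eval_cycleDistinctPoly, Finset.mul_sum]
  refine Finset.sum_congr rfl fun l _ => ?_
  rw [← Finset.mul_prod_erase univ _ (Finset.mem_univ l)]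
  have := sub_ne_zero.2 (hx l)
  field_simp

lemma eval_greenPoly_coe {n : ℕ} (i : Fin n) {x : ℝ}
    (hx : ∀ l : Fin (n / 2 + 1), x ≠ alphaVal n (2 * l)) : (greenPoly n i).eval x
    = (cycleDistinctPoly n).eval x * cycleGreen n x i := eval_greenPoly_of_ne i hx

lemma eval_secularPoly_of_ne {n m : ℕ} (w : Fin n → ℝ) (δ₀ δ : ℝ) {x : ℝ}
    (hx : ∀ l : Fin (n / 2 + 1), x ≠ alphaVal n (2 * l)) (hq : hubQuad m (∑ i, w i) x ≠ 0) :
    (secularPoly n m w δ₀ δ).eval x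
      = (cycleDistinctPoly n).eval x * hubQuad m (∑ i, w i) x * secular n m w δ₀ δ x := by
  rw [eval_secularPoly, eval_greenPoly_of_ne 0 hx, secular]
  simp only [eval_greenPoly_coe _ hx, Nat.cast_zero, mul_zero, zero_div, Real.cos_zero, mul_one]
  have : ∑ i, w i * ((cycleDistinctPoly n).eval x * cycleGreen n x i)
      = (cycleDistinctPoly n).eval x * ∑ i, w i * cycleGreen n x i := by
    rw [Finset.mul_sum]
    exact Finset.sum_congr rfl fun _ _ => by ring
  rw [this]
  field_simp
  ring

lemma monic_cycleDistinctPoly (n : ℕ) : (cycleDistinctPoly n).Monic :=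
  Polynomial.monic_prod_X_sub_C _ _

lemma natDegree_cycleDistinctPoly (n : ℕ) : (cycleDistinctPoly n).natDegree = n / 2 + 1 := by
  rw [cycleDistinctPoly, Polynomial.natDegree_finsetProd_X_sub_C_eq_card]
  simp

open Polynomial in
lemma hubPoly_eq (m : ℕ) (w : ℝ) :
    hubPoly m w = X ^ 2 + (-C (m + w) * X + C w) := by rw [hubPoly]; ring

open Polynomial in
lemma degree_hubPoly_tail (m : ℕ) (w : ℝ) : (-C (m + w) * X + C w : ℝ[X]).degree < (2 : ℕ) := by
  rw [← C_neg]
  exact degree_linear_le.trans_lt (by exact_mod_cast one_lt_two)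

lemma monic_hubPoly (m : ℕ) (w : ℝ) : (hubPoly m w).Monic := by
  rw [hubPoly_eq]
  exact Polynomial.monic_X_pow_add (degree_hubPoly_tail m w)

lemma natDegree_hubPoly (m : ℕ) (w : ℝ) : (hubPoly m w).natDegree = 2 := by
  rw [hubPoly_eq]
  rw [Polynomial.natDegree_add_eq_left_of_degree_lt, Polynomial.natDegree_X_pow]
  rw [Polynomial.degree_X_pow]
  exact degree_hubPoly_tail m w

lemma natDegree_greenPoly_le (n j : ℕ) : (greenPoly n j).natDegree ≤ n / 2 := by
  refine Polynomial.natDegree_sum_le_of_forall_le _ _ fun l _ => ?_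
  refine (Polynomial.natDegree_C_mul_le _ _).trans ?_
  rw [Polynomial.natDegree_finsetProd_X_sub_C_eq_card, Finset.card_erase_of_mem (Finset.mem_univ _)]
  simp

-- The terms carrying the modification have degree at most `n / 2 + 2`, so they touch neither the
-- degree nor the leading coefficient.
open Polynomial in
lemma secularPoly_monic_and_natDegree (n m : ℕ) (w : Fin n → ℝ) (δ₀ δ : ℝ) :
    (secularPoly n m w δ₀ δ).Monic ∧ (secularPoly n m w δ₀ δ).natDegree = n / 2 + 3 := by
  have hm : (cycleDistinctPoly n * hubPoly m (∑ i, w i)).Monic :=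
    (monic_cycleDistinctPoly n).mul (monic_hubPoly _ _)
  have hd : (cycleDistinctPoly n * hubPoly m (∑ i, w i)).natDegree = n / 2 + 3 := by
    rw [(monic_cycleDistinctPoly n).natDegree_mul (monic_hubPoly _ _),
      natDegree_cycleDistinctPoly, natDegree_hubPoly]
  have h1 : ((C δ - C δ₀ * X) * ∑ i : Fin n, C (w i) * greenPoly n i : ℝ[X]).natDegree
      ≤ n / 2 + 2 := by
    refine natDegree_mul_le.trans ?_
    have ha : (C δ - C δ₀ * X : ℝ[X]).natDegree ≤ 1 := by
      compute_degree
    have hb : (∑ i : Fin n, C (w i) * greenPoly n i : ℝ[X]).natDegree ≤ n / 2 :=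
      natDegree_sum_le_of_forall_le _ _ fun i _ =>
        (natDegree_C_mul_le _ _).trans (natDegree_greenPoly_le n i)
    omega
  have h2 : (C δ * hubPoly m (∑ i, w i) * greenPoly n 0 : ℝ[X]).natDegree ≤ n / 2 + 2 := by
    refine natDegree_mul_le.trans ?_
    have ha : (C δ * hubPoly m (∑ i, w i) : ℝ[X]).natDegree ≤ 2 :=
      (natDegree_C_mul_le _ _).trans (natDegree_hubPoly _ _).le
    have := natDegree_greenPoly_le n 0
    omega
  have hlt : ((C δ - C δ₀ * X) * ∑ i : Fin n, C (w i) * greenPoly n i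
      - C δ * hubPoly m (∑ i, w i) * greenPoly n 0 : ℝ[X]).natDegree
      < (cycleDistinctPoly n * hubPoly m (∑ i, w i)).natDegree := by
    rw [hd]
    exact (natDegree_sub_le_of_le h1 h2).trans_lt (by simp)
  exact ⟨hm.add_of_left (degree_lt_degree hlt),
    by rw [secularPoly, natDegree_add_eq_left_of_natDegree_lt hlt, hd]⟩

open Polynomial in
/-- The characteristic polynomial of the modified network. -/
lemma charpoly_cycleStarLaplacian {n k : ℕ} (hn : 3 ≤ n) (hk : 1 ≤ k) (w : Fin n → ℝ)
    (d : Fin (k + 1) → ℝ) :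
    (cycleStarLaplacian n (k + 1) w d).charpoly
      = cycleRepeatedPoly n * (X - C 1) ^ (k - 1) * secularPoly n (k + 1) w (d 0) (∑ j, d j) := by
  -- The determinant formula needs `x` outside the roots of `bad`. These are finitely many, which
  -- suffices for an identity of polynomials.
  set bad : ℝ[X] := cycleDistinctPoly n * hubPoly (k + 1) (∑ i, w i) * (X - C 1) with hbad
  have hbad0 : bad ≠ 0 :=
    (((monic_cycleDistinctPoly n).mul (monic_hubPoly _ _)).mul (monic_X_sub_C 1)).ne_zero
  refine eq_of_infinite_eval_eq _ _ ?_
  refine Set.Infinite.mono (s := (↑bad.roots.toFinset : Set ℝ)ᶜ) ?_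
    (Finset.finite_toSet _).infinite_compl
  intro x hx
  have hb : bad.eval x ≠ 0 := by
    intro h
    exact hx (by simpa using ⟨hbad0, h⟩)
  rw [hbad, eval_mul, eval_mul, eval_hubPoly, eval_cycleDistinctPoly] at hb
  have hE := left_ne_zero_of_mul (left_ne_zero_of_mul hb)
  have hq := right_ne_zero_of_mul (left_ne_zero_of_mul hb)
  have h1 := right_ne_zero_of_mul hb
  have hxl : ∀ l : Fin (n / 2 + 1), x ≠ alphaVal n (2 * l) := fun l h =>
    Finset.prod_ne_zero_iff.1 hE l (Finset.mem_univ l) (sub_eq_zero.2 h)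
  have hx1 : x ≠ 1 := by simpa [sub_eq_zero] using h1
  simp only [Set.mem_ofPred_eq]
  rw [eval_charpoly_cycleStarLaplacian hn hk w d hxl hx1 hq, eval_mul, eval_mul,
    eval_secularPoly_of_ne w _ _ hxl hq, eval_cycleDistinctPoly, cycleRepeatedPoly, eval_prod,
    ← Finset.prod_range_mul_prod_Ico (fun k => x - alphaVal n (2 * k)) (show n / 2 + 1 ≤ n by omega),
    Finset.prod_range (fun k => x - alphaVal n (2 * k))]
  simp only [eval_pow, eval_sub, eval_X, eval_C]
  ring

/-- Only the mode `l = 1` survives: every other summand keeps the vanishing factor of `α₂`. -/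
lemma eval_greenPoly_alphaVal_two {n : ℕ} (hn : 3 ≤ n) (j : ℕ) :
    (greenPoly n j).eval (alphaVal n 2) = cycleWeight n ⟨1, by omega⟩
      * Real.cos (2 * (j : ℝ) * Real.pi / n)
      * ∏ l ∈ univ.erase (⟨1, by omega⟩ : Fin (n / 2 + 1)), (alphaVal n 2 - alphaVal n (2 * l)) := by
  rw [eval_greenPoly, Finset.sum_eq_single (⟨1, by omega⟩ : Fin (n / 2 + 1))]
  · simp only [Nat.cast_one, mul_one]
    congr 4
    ring
  · intro b _ hb
    rw [mul_eq_zero]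
    right
    refine Finset.prod_eq_zero (i := (⟨1, by omega⟩ : Fin (n / 2 + 1))) (by simp [hb.symm]) ?_
    simp
  · simp

lemma eval_secularPoly_alphaVal_two {n m : ℕ} (hn : 3 ≤ n) (w : Fin n → ℝ) (δ₀ δ : ℝ)
    (hq : hubQuad m (∑ i, w i) (alphaVal n 2) ≠ 0) :
    (secularPoly n m w δ₀ δ).eval (alphaVal n 2)
      = -(cycleWeight n ⟨1, by omega⟩ * gapSign m n w δ₀ δ) *
        (hubQuad m (∑ i, w i) (alphaVal n 2) *
        ∏ l ∈ univ.erase (⟨1, by omega⟩ : Fin (n / 2 + 1)), (alphaVal n 2 - alphaVal n (2 * l))) := by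
  have hE : (cycleDistinctPoly n).eval (alphaVal n 2) = 0 := by
    rw [eval_cycleDistinctPoly]
    exact Finset.prod_eq_zero (Finset.mem_univ (⟨1, by omega⟩ : Fin (n / 2 + 1))) (by simp)
  rw [eval_secularPoly, hE]
  simp only [eval_greenPoly_alphaVal_two hn, Nat.cast_zero, mul_zero, zero_mul, zero_div,
    Real.cos_zero, mul_one]
  rw [gapSign]
  set P := ∏ l ∈ univ.erase (⟨1, by omega⟩ : Fin (n / 2 + 1)), (alphaVal n 2 - alphaVal n (2 * l))
  have : ∑ i : Fin n, w i * (cycleWeight n ⟨1, by omega⟩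
      * Real.cos (2 * ((i : ℕ) : ℝ) * Real.pi / n) * P)
      = cycleWeight n ⟨1, by omega⟩ * P
        * ∑ i : Fin n, w i * Real.cos (2 * ((i : ℕ) : ℝ) * Real.pi / n) := by
    rw [Finset.mul_sum]
    exact Finset.sum_congr rfl fun _ _ => by ring
  rw [this]
  rw [show alphaVal n 2 ^ 2 - (m + ∑ i, w i) * alphaVal n 2 + ∑ i, w i
    = hubQuad m (∑ i, w i) (alphaVal n 2) from rfl]
  generalize ∑ i : Fin n, w i * Real.cos (2 * ((i : ℕ) : ℝ) * Real.pi / n) = t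
  field_simp
  ring

/-! ### Perturbation of polynomials with simple real roots -/

lemma prod_mul_prod_neg_of_exactly_one {ι : Type*} [Fintype ι] [DecidableEq ι] {f g : ι → ℝ} (i : ι)
    (hi : f i * g i < 0) (h : ∀ j, j ≠ i → 0 < f j * g j) : (∏ j, f j) * ∏ j, g j < 0 := by
  rw [← Finset.prod_mul_distrib, ← Finset.mul_prod_erase univ _ (Finset.mem_univ i)]
  exact mul_neg_of_neg_of_pos hi
    (Finset.prod_pos fun j hj => h j (Finset.ne_of_mem_erase hj))

open Polynomial in
/-- A monic polynomial which has the same signs as a polynomial with simple real roots on both sides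
of each root has simple real roots itself, close to the given ones. -/
lemma exists_roots_of_same_signs {ι : Type*} [Fintype ι] {r : ι → ℝ} {η : ℝ}
    (hη : 0 < η) (hsep : ∀ i j, i ≠ j → 2 * η ≤ |r i - r j|) {p : ℝ[X]} (hp : p.Monic)
    (hdeg : p.natDegree = Fintype.card ι)
    (hleft : ∀ i, 0 < p.eval (r i - η) * ∏ j, (r i - η - r j))
    (hright : ∀ i, 0 < p.eval (r i + η) * ∏ j, (r i + η - r j)) :
    ∃ s : ι → ℝ, (∀ i, |s i - r i| < η) ∧ p = ∏ i, (X - C (s i)) := by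
  classical
  have hroot : ∀ i, ∃ s, |s - r i| < η ∧ p.eval s = 0 := by
    intro i
    have hneg : (∏ j, (r i - η - r j)) * ∏ j, (r i + η - r j) < 0 := by
      -- The factor of `r i` contributes `-η ^ 2`; every other one contributes `(r i - r j) ^ 2 - η
      -- ^ 2`, which is positive by separation.
      refine prod_mul_prod_neg_of_exactly_one i (by nlinarith) fun j hj => ?_
      have h1 := hsep i j hj.symm
      have h2 : (2 * η) ^ 2 ≤ (r i - r j) ^ 2 := by
        rw [← sq_abs (r i - r j)]
        exact pow_le_pow_left₀ (by positivity) h1 2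
      nlinarith
    have hsign : p.eval (r i - η) * p.eval (r i + η) < 0 := by
      by_contra! h
      have := mul_pos (hleft i) (hright i)
      nlinarith [mul_nonneg_of_nonpos_of_nonpos hneg.le (neg_nonpos.2 h)]
    have hcont : ContinuousOn (fun x => p.eval x) (Set.Icc (r i - η) (r i + η)) :=
      p.continuous.continuousOn
    have hle : r i - η ≤ r i + η := by linarith
    rcases mul_neg_iff.1 hsign with h | h
    · obtain ⟨s, hs, hs0⟩ := intermediate_value_Ioo' hle hcont ⟨h.2, h.1⟩
      exact ⟨s, abs_lt.2 ⟨by linarith [hs.1], by linarith [hs.2]⟩, hs0⟩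
    · obtain ⟨s, hs, hs0⟩ := intermediate_value_Ioo hle hcont ⟨h.1, h.2⟩
      exact ⟨s, abs_lt.2 ⟨by linarith [hs.1], by linarith [hs.2]⟩, hs0⟩
  choose s hs hs0 using hroot
  refine ⟨s, hs, ?_⟩
  have hinj : Function.Injective s := by
    intro i j hij
    by_contra hne
    have h1 := hsep i j hne
    have h2 : |r i - r j| ≤ |s i - r i| + |s j - r j| := by
      rw [abs_sub_comm (s i), hij]
      exact abs_sub_le _ _ _
    linarith [hs i, hs j]
  -- The intervals are disjoint, so the roots found are distinct; by the degree hypothesis they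
  -- exhaust `p`.
  have hdvd : ∏ i, (X - C (s i)) ∣ p :=
    Finset.prod_dvd_of_coprime
      (fun i _ j _ hij => pairwise_coprime_X_sub_C hinj hij)
      fun i _ => dvd_iff_isRoot.2 (hs0 i)
  refine eq_of_monic_of_dvd_of_natDegree_le (monic_prod_X_sub_C _ _) hp hdvd ?_
  rw [natDegree_finsetProd_X_sub_C_eq_card, hdeg, Finset.card_univ]

/-- A root of a perturbed polynomial lies on the side prescribed by the sign of the polynomial at the
unperturbed root. -/
lemma prod_erase_mul_prod_erase_pos {ι : Type*} [Fintype ι] [DecidableEq ι] {r s : ι → ℝ} {η : ℝ}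
    (hsep : ∀ i j, i ≠ j → 2 * η ≤ |r i - r j|) (hs : ∀ i, |s i - r i| < η) (i : ι) :
    0 < (∏ j ∈ univ.erase i, (r i - s j)) * ∏ j ∈ univ.erase i, (r i - r j) := by
  rw [← Finset.prod_mul_distrib]
  refine Finset.prod_pos fun j hj => ?_
  have h1 := hsep i j (Finset.ne_of_mem_erase hj).symm
  have h2 := abs_lt.1 (hs j)
  rcases le_abs'.1 h1 with h | h
  · exact mul_pos_of_neg_of_neg (by linarith) (by linarith)
  · exact mul_pos (by linarith) (by linarith)

lemma exists_separation {ι : Type*} [Finite ι] {r : ι → ℝ} (hr : Function.Injective r) :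
    ∃ η : ℝ, 0 < η ∧ ∀ i j, i ≠ j → 2 * η ≤ |r i - r j| := by
  have h : ∀ᶠ η in nhdsWithin (0 : ℝ) (Set.Ioi 0), ∀ i j, i ≠ j → 2 * η ≤ |r i - r j| := by
    refine Filter.eventually_all.2 fun i => Filter.eventually_all.2 fun j => ?_
    by_cases hij : i = j
    · simp [hij]
    · have hpos : 0 < |r i - r j| := abs_pos.2 (sub_ne_zero.2 (hr.ne hij))
      filter_upwards [Ioo_mem_nhdsGT (show (0 : ℝ) < |r i - r j| / 2 by positivity)] with η hη _
      linarith [hη.2]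
  obtain ⟨η, h1, h2⟩ := (h.and self_mem_nhdsWithin).exists
  exact ⟨η, h2, h1⟩

/-! ### The second entry of the sorted spectrum -/

/-- Two distinct members cannot both be the head of the sorted list, so one of them is at least the
second entry. They also rule out lists too short to avoid the default value. -/
lemma getD_one_sort_le {s : Multiset ℝ} {a b c : ℝ} (ha : a ∈ s) (hb : b ∈ s) (hab : a ≠ b)
    (hac : a ≤ c) (hbc : b ≤ c) : (s.sort (· ≤ ·)).getD 1 0 ≤ c := by
  have hsort := Multiset.pairwise_sort s (· ≤ ·)
  rw [← Multiset.mem_sort (r := (· ≤ ·))] at ha hb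
  match hL : s.sort (· ≤ ·), hsort with
  | [], _ => simp [hL] at ha
  | [x], _ =>
    simp only [hL, List.mem_singleton] at ha hb
    exact absurd (ha.trans hb.symm) hab
  | x :: y :: L, hsort =>
    rw [hL] at ha hb
    simp only [List.getD_cons_succ, List.getD_cons_zero]
    have hy := (List.pairwise_cons.1 (List.pairwise_cons.1 hsort).2).1
    have key : ∀ z ∈ x :: y :: L, z = x ∨ y ≤ z := by
      intro z hz
      rcases List.mem_cons.1 hz with h | h
      · exact Or.inl h
      · rcases List.mem_cons.1 h with h | h
        · exact Or.inr h.ge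
        · exact Or.inr (hy z h)
    rcases key a ha with h | h
    · rcases key b hb with h' | h'
      · exact absurd (h.trans h'.symm) hab
      · exact h'.trans hbc
    · exact h.trans hac

lemma getD_one_sort_cons_mem {t : Multiset ℝ} {a : ℝ} (ht : t ≠ 0) (h : ∀ x ∈ t, a ≤ x) :
    ((a ::ₘ t).sort (· ≤ ·)).getD 1 0 ∈ t := by
  have hsort : (a ::ₘ t).sort (· ≤ ·) = a :: t.sort (· ≤ ·) := Multiset.sort_cons _ _ _ h
  rw [hsort, List.getD_cons_succ, ← Multiset.mem_sort (r := (· ≤ ·))]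
  match hL : t.sort (· ≤ ·) with
  | [] =>
    have := Multiset.sort_eq t (· ≤ ·)
    rw [hL] at this
    exact absurd this.symm ht
  | x :: L => simp

section Spectrum

variable {V : Type*} [Fintype V] [DecidableEq V]

lemma mem_complexEigenvalues_of_eval_charpoly {M : Matrix V V ℝ} {x : ℝ}
    (hx : M.charpoly.eval x = 0) : (x : ℂ) ∈ complexEigenvalues M := by
  rw [complexEigenvalues, Polynomial.mem_roots (Matrix.charpoly_monic _).ne_zero,
    Polynomial.IsRoot.def]
  have h := Matrix.charpoly_map M (algebraMap ℝ ℂ)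
  change (M.map (algebraMap ℝ ℂ)).charpoly.eval (algebraMap ℝ ℂ x) = 0
  rw [h, Polynomial.eval_map_apply, hx, map_zero]

/-- Two distinct real eigenvalues bound the real part of the second eigenvalue. -/
lemma reLambda2_le_of_roots {M : Matrix V V ℝ} {a b c : ℝ} (ha : M.charpoly.eval a = 0)
    (hb : M.charpoly.eval b = 0) (hab : a ≠ b) (hac : a ≤ c) (hbc : b ≤ c) : reLambda2 M ≤ c :=
  getD_one_sort_le
    (Multiset.mem_map.2 ⟨a, mem_complexEigenvalues_of_eval_charpoly ha, Complex.ofReal_re a⟩)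
    (Multiset.mem_map.2 ⟨b, mem_complexEigenvalues_of_eval_charpoly hb, Complex.ofReal_re b⟩)
    hab hac hbc

open Polynomial in
lemma complexEigenvalues_of_charpoly_eq {M : Matrix V V ℝ} {s : Multiset ℝ}
    (h : M.charpoly = (s.map fun a => X - C a).prod) :
    complexEigenvalues M = s.map fun x : ℝ => (x : ℂ) := by
  have h1 := Matrix.charpoly_map M (algebraMap ℝ ℂ)
  change (M.map (algebraMap ℝ ℂ)).charpoly.roots = _
  rw [h1, h, Polynomial.map_multiset_prod, Multiset.map_map]
  have : (Polynomial.map (algebraMap ℝ ℂ) ∘ fun a : ℝ => X - C a)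
      = (fun z : ℂ => X - C z) ∘ fun a : ℝ => (a : ℂ) := by
    ext1 a
    simp
  rw [this, ← Multiset.map_map, roots_multiset_prod_X_sub_C]

open Polynomial in
lemma hasRealSpectrum_of_charpoly_eq {M : Matrix V V ℝ} {s : Multiset ℝ}
    (h : M.charpoly = (s.map fun a => X - C a).prod) : HasRealSpectrum M := by
  intro z hz
  rw [complexEigenvalues_of_charpoly_eq h] at hz
  obtain ⟨x, -, rfl⟩ := Multiset.mem_map.1 hz
  exact Complex.ofReal_im x

open Polynomial in
lemma reLambda2_mem_of_charpoly_eq {M : Matrix V V ℝ} {t : Multiset ℝ} {a : ℝ}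
    (h : M.charpoly = ((a ::ₘ t).map fun a => X - C a).prod) (ht : t ≠ 0) (hat : ∀ x ∈ t, a ≤ x) :
    reLambda2 M ∈ t := by
  rw [reLambda2, complexEigenvalues_of_charpoly_eq h, Multiset.map_map]
  have : (Complex.re ∘ fun x : ℝ => (x : ℂ)) = id := by ext1 x; simp
  rw [this, Multiset.map_id]
  exact getD_one_sort_cons_mem ht hat

end Spectrum

/-! ### Roots of the hub quadratic and the unperturbed roots -/

/-- `β⁺_{m,w}`, the larger root of `hubQuad`. -/
def betaPlus (m : ℕ) (w : ℝ) : ℝ := ((m + w) + √((m + w) ^ 2 - 4 * w)) / 2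

lemma hubQuad_eq {m : ℕ} (hm : 1 ≤ m) (w x : ℝ) :
    hubQuad m w x = (x - betaMinus m w) * (x - betaPlus m w) := by
  have hm' : (1 : ℝ) ≤ m := by exact_mod_cast hm
  have h := Real.sq_sqrt (show 0 ≤ ((m : ℝ) + w) ^ 2 - 4 * w by nlinarith [sq_nonneg (w + m - 2)])
  rw [hubQuad, betaMinus, betaPlus]
  linear_combination (1 / 4) * h

lemma betaMinus_lt_one {m : ℕ} (hm : 2 ≤ m) (w : ℝ) : betaMinus m w < 1 := by
  have hm' : (2 : ℝ) ≤ m := by exact_mod_cast hm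
  have h : (m : ℝ) + w - 2 < √((m + w) ^ 2 - 4 * w) := by
    refine Real.lt_sqrt_of_sq_lt ?_
    nlinarith
  rw [betaMinus]
  linarith

lemma betaPlus_gt {m : ℕ} (hm : 2 ≤ m) {w : ℝ} (hw : 0 < w) : (m : ℝ) < betaPlus m w := by
  have hm' : (2 : ℝ) ≤ m := by exact_mod_cast hm
  have h : (m : ℝ) - w < √((m + w) ^ 2 - 4 * w) := by
    refine Real.lt_sqrt_of_sq_lt ?_
    nlinarith
  rw [betaPlus]
  linarith

lemma betaMinus_zero (m : ℕ) : betaMinus m 0 = 0 := by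
  simp [betaMinus]

lemma betaMinus_pos {m : ℕ} (hm : 2 ≤ m) {w : ℝ} (hw : 0 < w) : 0 < betaMinus m w := by
  have hq := hubQuad_eq (m := m) (by omega) w 0
  have hp := betaPlus_gt hm hw
  have hm' : (0 : ℝ) ≤ m := by positivity
  simp only [hubQuad] at hq
  by_contra! h
  nlinarith

/-- The zeros of the unperturbed `secularPoly`. -/
def baseRoots (n m : ℕ) (w : ℝ) : Fin (n / 2 + 1) ⊕ Fin 2 → ℝ :=
  Sum.elim (fun l => alphaVal n (2 * l)) ![betaMinus m w, betaPlus m w]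

lemma prod_sub_baseRoots {n m : ℕ} (hm : 1 ≤ m) (w x : ℝ) :
    ∏ j, (x - baseRoots n m w j) = (cycleDistinctPoly n).eval x * hubQuad m w x := by
  rw [Fintype.prod_sum_type, Fin.prod_univ_two, hubQuad_eq hm, eval_cycleDistinctPoly]
  simp [baseRoots]

/-- `β⁺` lies beyond `m ≥ 4`, hence beyond all `α_{2l} ≤ 4` and beyond `β⁻ < 1`; the only
coincidence left to exclude is `β⁻ = α_{2l}`. -/
lemma baseRoots_injective {n m : ℕ} (hm : 4 ≤ m) {w : ℝ} (hw : 0 < w)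
    (hβ : ∀ l : ℕ, l ≤ n → betaMinus m w ≠ alphaVal n l) :
    Function.Injective (baseRoots n m w) := by
  have hp : (4 : ℝ) < betaPlus m w :=
    lt_of_le_of_lt (by exact_mod_cast hm) (betaPlus_gt (m := m) (by omega) hw)
  have h1 := betaMinus_lt_one (m := m) (by omega) w
  refine Function.Injective.sumElim (alphaVal_two_mul_injective n) ?_ ?_
  · intro i j hij
    fin_cases i <;> fin_cases j <;> simp at hij ⊢ <;> linarith
  · intro l j
    fin_cases j
    · exact (hβ _ (by have := l.2; omega)).symm
    · exact ((alphaVal_le_four n _).trans_lt hp).ne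

/-- At `0` only the constant mode survives, and it does not see the node. -/
lemma eval_greenPoly_zero (n j : ℕ) : (greenPoly n j).eval 0 = (greenPoly n 0).eval 0 := by
  rw [eval_greenPoly, eval_greenPoly]
  refine Finset.sum_congr rfl fun l _ => ?_
  by_cases hl : l = 0
  · simp [hl]
  · rw [Finset.prod_eq_zero (i := (0 : Fin (n / 2 + 1))) (by simp [Ne.symm hl])
      (by simp [alphaVal_zero])]
    simp

/-- The Laplacian keeps the eigenvalue `0`; here the two correction terms cancel because `hubQuad`
at `0` is the total weight. -/
lemma eval_secularPoly_zero (n m : ℕ) (w : Fin n → ℝ) (δ₀ δ : ℝ) :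
    (secularPoly n m w δ₀ δ).eval 0 = 0 := by
  have hE : (cycleDistinctPoly n).eval 0 = 0 := by
    rw [eval_cycleDistinctPoly]
    exact Finset.prod_eq_zero (Finset.mem_univ 0) (by simp [alphaVal_zero])
  rw [eval_secularPoly, hE]
  simp only [fun i : Fin n => eval_greenPoly_zero n i, ← Finset.sum_mul, hubQuad]
  ring

lemma secularPoly_zero_zero {n m : ℕ} (hm : 1 ≤ m) (w : Fin n → ℝ) :
    secularPoly n m w 0 0
      = ∏ j, (Polynomial.X - Polynomial.C (baseRoots n m (∑ i, w i) j)) := by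
  refine Polynomial.funext fun x => ?_
  rw [Polynomial.eval_prod]
  simp only [Polynomial.eval_sub, Polynomial.eval_X, Polynomial.eval_C]
  rw [prod_sub_baseRoots hm, eval_secularPoly]
  simp

/-! ### Motion of the roots under small modifications -/

/-- The roots of `secularPoly` vary continuously with the modification, uniformly in its direction. -/
lemma exists_secularPoly_roots {n k : ℕ} (hk : 3 ≤ k) (w : Fin n → ℝ) {η : ℝ} (hη : 0 < η)
    (hsep : ∀ i j, i ≠ j →
      2 * η ≤ |baseRoots n (k + 1) (∑ i, w i) i - baseRoots n (k + 1) (∑ i, w i) j|) :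
    ∃ ε : ℝ, 0 < ε ∧ ∀ d : Fin (k + 1) → ℝ, (∀ j, 0 ≤ d j) → (∀ j, d j < ε) →
      ∃ s : Fin (n / 2 + 1) ⊕ Fin 2 → ℝ,
        (∀ i, |s i - baseRoots n (k + 1) (∑ i, w i) i| < η) ∧
        secularPoly n (k + 1) w (d 0) (∑ j, d j)
          = ∏ i, (Polynomial.X - Polynomial.C (s i)) := by
  set r := baseRoots n (k + 1) (∑ i, w i) with hr
  have hev : ∀ x : ℝ, ∏ j, (x - r j) ≠ 0 → ∀ᶠ d : Fin (k + 1) → ℝ in nhds 0,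
      0 < (secularPoly n (k + 1) w (d 0) (∑ j, d j)).eval x * ∏ j, (x - r j) := by
    intro x hx
    have hcont : Continuous fun d : Fin (k + 1) → ℝ =>
        (secularPoly n (k + 1) w (d 0) (∑ j, d j)).eval x * ∏ j, (x - r j) := by
      simp only [eval_secularPoly]
      fun_prop
    refine hcont.continuousAt.eventually (lt_mem_nhds ?_)
    simp only [Pi.zero_apply, Finset.sum_const_zero]
    rw [secularPoly_zero_zero (by omega), Polynomial.eval_prod]
    simp only [Polynomial.eval_sub, Polynomial.eval_X, Polynomial.eval_C]
    exact mul_self_pos.2 hx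
  have hne : ∀ i, ∀ y : ℝ, |y| = η → ∏ j, (r i + y - r j) ≠ 0 := by
    intro i y hy
    refine Finset.prod_ne_zero_iff.2 fun j _ h => ?_
    have h1 : r i - r j = -y := by linarith
    by_cases hij : i = j
    · rw [hij, sub_self] at h1
      rw [show y = 0 by linarith, abs_zero] at hy
      exact hη.ne hy
    · have := hsep i j hij
      rw [h1, abs_neg, hy] at this
      linarith
  have hall : ∀ᶠ d : Fin (k + 1) → ℝ in nhds 0, ∀ i,
      0 < (secularPoly n (k + 1) w (d 0) (∑ j, d j)).eval (r i - η) * ∏ j, (r i - η - r j) ∧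
      0 < (secularPoly n (k + 1) w (d 0) (∑ j, d j)).eval (r i + η) * ∏ j, (r i + η - r j) := by
    refine Filter.eventually_all.2 fun i => (hev _ ?_).and (hev _ ?_)
    · exact hne i (-η) (by rw [abs_neg, abs_of_pos hη])
    · exact hne i η (abs_of_pos hη)
  obtain ⟨ε, hε, hball⟩ := Metric.eventually_nhds_iff.1 hall
  refine ⟨ε, hε, fun d hd0 hd => ?_⟩
  have hdist : dist d 0 < ε := by
    rw [dist_pi_lt_iff hε]
    intro j
    rw [Pi.zero_apply, Real.dist_eq, sub_zero, abs_of_nonneg (hd0 j)]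
    exact hd j
  have h := hball hdist
  obtain ⟨hmonic, hdeg⟩ := secularPoly_monic_and_natDegree n (k + 1) w (d 0) (∑ j, d j)
  exact exists_roots_of_same_signs hη hsep hmonic (by simp [hdeg])
    (fun i => (h i).1) (fun i => (h i).2)

/-- A perturbed root lies on the side prescribed by the sign at the unperturbed root. -/
lemma root_side {ι : Type*} [Fintype ι] [DecidableEq ι] {r s : ι → ℝ} {η c : ℝ}
    (hsep : ∀ i j, i ≠ j → 2 * η ≤ |r i - r j|) (hs : ∀ i, |s i - r i| < η) (i : ι)
    (h : ∏ j, (r i - s j) = -(c * ∏ j ∈ univ.erase i, (r i - r j))) :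
    (0 < c → r i < s i) ∧ (c < 0 → s i < r i) := by
  have hpos := prod_erase_mul_prod_erase_pos hsep hs i
  rw [← Finset.mul_prod_erase univ _ (Finset.mem_univ i)] at h
  set A := ∏ j ∈ univ.erase i, (r i - s j)
  set B := ∏ j ∈ univ.erase i, (r i - r j)
  have hB : 0 < B ^ 2 := sq_pos_of_ne_zero (right_ne_zero_of_mul hpos.ne')
  -- Multiplying by `B` brings in the positive number `A * B`, so the side is read off from `c`
  -- alone.
  have h2 : (r i - s i) * (A * B) = -(c * B ^ 2) := by linear_combination B * h
  constructor
  · intro hc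
    by_contra! hle
    nlinarith [mul_nonneg (sub_nonneg.2 hle) hpos.le, mul_pos hc hB]
  · intro hc
    by_contra! hle
    nlinarith [mul_nonneg (sub_nonneg.2 hle) hpos.le, mul_neg_of_neg_of_pos hc hB]

lemma prod_erase_inl {α β : Type*} [Fintype α] [Fintype β] [DecidableEq α] [DecidableEq β]
    (f : α ⊕ β → ℝ) (i : α) : ∏ j ∈ univ.erase (Sum.inl i), f j
      = (∏ a ∈ univ.erase i, f (Sum.inl a)) * ∏ b, f (Sum.inr b) := by
  have : (univ.erase (Sum.inl i) : Finset (α ⊕ β)) = (univ.erase i).disjSum univ := by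
    ext (a | a) <;> simp
  rw [this, Finset.prod_disjSum]

lemma prod_erase_inr {α β : Type*} [Fintype α] [Fintype β] [DecidableEq α] [DecidableEq β]
    (f : α ⊕ β → ℝ) (i : β) : ∏ j ∈ univ.erase (Sum.inr i), f j
      = (∏ a, f (Sum.inl a)) * ∏ b ∈ univ.erase i, f (Sum.inr b) := by
  have : (univ.erase (Sum.inr i) : Finset (α ⊕ β)) = univ.disjSum (univ.erase i) := by
    ext (a | a) <;> simp
  rw [this, Finset.prod_disjSum]

/-! ### Spectrum of the modified network -/

/-- All eigenvalues of the modified network except for the eigenvalue `0`, in terms of the roots of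
`secularPoly`. -/
def spectrumTail (n k : ℕ) (s : Fin (n / 2 + 1) ⊕ Fin 2 → ℝ) : Multiset ℝ :=
  (univ.erase (Sum.inl 0)).val.map s
    + ((Ico (n / 2 + 1) n).val.map (fun l => alphaVal n (2 * l)) + Multiset.replicate (k - 1) 1)

section Tail

variable {n k : ℕ} {w : Fin n → ℝ} {d : Fin (k + 1) → ℝ} {s : Fin (n / 2 + 1) ⊕ Fin 2 → ℝ}

lemma charpoly_eq_prod_spectrumTail (hn : 3 ≤ n) (hk : 1 ≤ k)
    (hs : secularPoly n (k + 1) w (d 0) (∑ j, d j) = ∏ i, (Polynomial.X - Polynomial.C (s i))) :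
    (cycleStarLaplacian n (k + 1) w d).charpoly
      = ((s (Sum.inl 0) ::ₘ spectrumTail n k s).map
          fun a => Polynomial.X - Polynomial.C a).prod := by
  rw [charpoly_cycleStarLaplacian hn hk, hs, spectrumTail, Multiset.map_cons, Multiset.prod_cons,
    Multiset.map_add, Multiset.map_add, Multiset.prod_add, Multiset.prod_add, Multiset.map_map,
    Multiset.map_map, Multiset.map_replicate, Multiset.prod_replicate, cycleRepeatedPoly,
    ← Finset.mul_prod_erase univ _ (Finset.mem_univ (Sum.inl 0))]
  simp only [Finset.prod, Function.comp_def]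
  ring

lemma hasRealSpectrum_cycleStarLaplacian (hn : 3 ≤ n) (hk : 1 ≤ k)
    (hs : secularPoly n (k + 1) w (d 0) (∑ j, d j) = ∏ i, (Polynomial.X - Polynomial.C (s i))) :
    HasRealSpectrum (cycleStarLaplacian n (k + 1) w d) :=
  hasRealSpectrum_of_charpoly_eq (charpoly_eq_prod_spectrumTail hn hk hs)

/-- The second eigenvalue inherits every property shared by the eigenvalues other than `0`. -/
lemma reLambda2_cycleStarLaplacian_induction (hn : 3 ≤ n) (hk : 1 ≤ k)
    (hs : secularPoly n (k + 1) w (d 0) (∑ j, d j) = ∏ i, (Polynomial.X - Polynomial.C (s i)))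
    (hs0 : s (Sum.inl 0) = 0) {P : ℝ → Prop} (hP : ∀ i, i ≠ Sum.inl 0 → P (s i))
    (h1 : P 1) (hα : ∀ l, l < n → l ≠ 0 → P (alphaVal n (2 * l))) (hnonneg : ∀ x, P x → 0 ≤ x) :
    P (reLambda2 (cycleStarLaplacian n (k + 1) w d)) := by
  have htail : ∀ x ∈ spectrumTail n k s, P x := by
    intro x hx
    rw [spectrumTail, Multiset.mem_add, Multiset.mem_add] at hx
    rcases hx with hx | hx | hx
    · obtain ⟨i, hi, rfl⟩ := Multiset.mem_map.1 hx
      exact hP i (Finset.ne_of_mem_erase (Finset.mem_val.mp hi))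
    · obtain ⟨l, hl, rfl⟩ := Multiset.mem_map.1 hx
      have := Finset.mem_Ico.1 (Finset.mem_val.mp hl)
      exact hα l this.2 (by omega)
    · rw [Multiset.eq_of_mem_replicate hx]
      exact h1
  refine htail _ (reLambda2_mem_of_charpoly_eq (charpoly_eq_prod_spectrumTail hn hk hs) ?_ ?_)
  -- The tail is nonempty because it contains the root near `β⁻`, in slot `Sum.inr 0`.
  · intro h
    have : s (Sum.inr 0) ∈ spectrumTail n k s := by
      rw [spectrumTail, Multiset.mem_add]
      exact Or.inl (Multiset.mem_map_of_mem _ (Finset.mem_val.mpr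
        (Finset.mem_erase.2 ⟨Sum.inr_ne_inl, Finset.mem_univ _⟩)))
    rw [h] at this
    simp at this
  · intro x hx
    rw [hs0]
    exact hnonneg x (htail x hx)

lemma eval_charpoly_zero (hn : 3 ≤ n) (hk : 1 ≤ k) (w : Fin n → ℝ) (d : Fin (k + 1) → ℝ) :
    (cycleStarLaplacian n (k + 1) w d).charpoly.eval 0 = 0 := by
  rw [charpoly_cycleStarLaplacian hn hk, Polynomial.eval_mul, eval_secularPoly_zero, mul_zero]

lemma eval_charpoly_of_eval_secularPoly (hn : 3 ≤ n) (hk : 1 ≤ k) {x : ℝ}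
    (h : (secularPoly n (k + 1) w (d 0) (∑ j, d j)).eval x = 0) :
    (cycleStarLaplacian n (k + 1) w d).charpoly.eval x = 0 := by
  rw [charpoly_cycleStarLaplacian hn hk, Polynomial.eval_mul, h, mul_zero]

lemma alphaVal_two_pos (hn : 3 ≤ n) : 0 < alphaVal n 2 := by
  rw [← alphaVal_zero n]
  exact alphaVal_lt_alphaVal (by omega) (by omega)

/-- `α₂` is an eigenvalue of every modified network. -/
lemma eval_charpoly_alphaVal_two (hn : 3 ≤ n) (hk : 1 ≤ k) (w : Fin n → ℝ) (d : Fin (k + 1) → ℝ) :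
    (cycleStarLaplacian n (k + 1) w d).charpoly.eval (alphaVal n 2) = 0 := by
  rw [charpoly_cycleStarLaplacian hn hk, Polynomial.eval_mul, Polynomial.eval_mul,
    cycleRepeatedPoly, Polynomial.eval_prod,
    -- Frequency `n - 1` folds to `1`, so a copy of `α₂` sits in the factor that does not depend on
    -- `d`.
    Finset.prod_eq_zero (i := n - 1) (Finset.mem_Ico.2 ⟨by omega, by omega⟩), zero_mul, zero_mul]
  have h := alphaVal_fold (show n - 1 < n by omega)
  rw [show min (n - 1) (n - (n - 1)) = 1 by omega] at h
  simp [h]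

/-- No smallness of `d` is needed: `0` and `α₂` are distinct eigenvalues of every modified network.
-/
lemma reLambda2_le_alphaVal_two (hn : 3 ≤ n) (hk : 1 ≤ k) (w : Fin n → ℝ) (d : Fin (k + 1) → ℝ) :
    reLambda2 (cycleStarLaplacian n (k + 1) w d) ≤ alphaVal n 2 :=
  reLambda2_le_of_roots (eval_charpoly_zero hn hk w d) (eval_charpoly_alphaVal_two hn hk w d)
    (alphaVal_two_pos hn).ne (alphaVal_two_pos hn).le le_rfl

end Tail

/-! ### Global modification with `S < 0` -/

/-- The cosine transform of the weights at the `l`-th distinct eigenvalue of the cycle. -/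
def weightCos (n : ℕ) (w : Fin n → ℝ) (l : ℕ) : ℝ :=
  ∑ i : Fin n, w i * Real.cos (2 * Real.pi * l * (i : ℕ) / n)

lemma weightCos_le {n : ℕ} {w : Fin n → ℝ} (hw : ∀ i, 0 ≤ w i) (l : ℕ) :
    weightCos n w l ≤ ∑ i, w i :=
  Finset.sum_le_sum fun i _ => mul_le_of_le_one_right (hw i) (Real.cos_le_one _)

lemma weightCos_zero {n : ℕ} (w : Fin n → ℝ) : weightCos n w 0 = ∑ i, w i := by
  simp [weightCos]

lemma sum_mul_cycleGreen {n : ℕ} (w : Fin n → ℝ) (x : ℝ) :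
    ∑ i, w i * cycleGreen n x i = ∑ l : Fin (n / 2 + 1),
      cycleWeight n l / (x - alphaVal n (2 * l)) * weightCos n w l := by
  simp only [cycleGreen, weightCos, Finset.mul_sum]
  rw [Finset.sum_comm]
  exact Finset.sum_congr rfl fun l _ => Finset.sum_congr rfl fun i _ => by ring

/-- The residue-type factor of the `l`-th pole of `secular`. -/
def poleCoeff (n m : ℕ) (w : Fin n → ℝ) (δ₀ δ : ℝ) (l : ℕ) (x : ℝ) : ℝ :=
  δ - (δ - δ₀ * x) / hubQuad m (∑ i, w i) x * weightCos n w l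

lemma secular_eq_sum (n m : ℕ) (w : Fin n → ℝ) (δ₀ δ x : ℝ) :
    secular n m w δ₀ δ x = 1 - ∑ l : Fin (n / 2 + 1),
      cycleWeight n l / (x - alphaVal n (2 * l)) * poleCoeff n m w δ₀ δ l x := by
  rw [secular, sum_mul_cycleGreen, Finset.mul_sum, Finset.mul_sum, sub_add, ← Finset.sum_sub_distrib]
  congr 1
  exact Finset.sum_congr rfl fun l _ => by rw [poleCoeff]; ring

/-- `(α₂ - x)` times `secular`, continued to the closed interval `[0, α₂]`. -/
def clearedSecular (n m : ℕ) (w : Fin n → ℝ) (δ₀ δ : ℝ) (i₀ i₁ : Fin (n / 2 + 1)) (x : ℝ) : ℝ :=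
  (alphaVal n 2 - x) * (1 + cycleWeight n i₀ * (δ * (m + ∑ i, w i - x) - δ₀ * ∑ i, w i)
        / hubQuad m (∑ i, w i) x
      + ∑ l ∈ (univ.erase i₀).erase i₁,
        cycleWeight n l / (alphaVal n (2 * l) - x) * poleCoeff n m w δ₀ δ l x)
    + cycleWeight n i₁ * poleCoeff n m w δ₀ δ 1 x

lemma clearedSecular_eq {n m : ℕ} {w : Fin n → ℝ} {δ₀ δ x : ℝ} {i₀ i₁ : Fin (n / 2 + 1)}
    (h0 : (i₀ : ℕ) = 0) (h1 : (i₁ : ℕ) = 1) (hx0 : x ≠ 0) (hx1 : x ≠ alphaVal n 2)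
    (hq : hubQuad m (∑ i, w i) x ≠ 0) :
    clearedSecular n m w δ₀ δ i₀ i₁ x = (alphaVal n 2 - x) * secular n m w δ₀ δ x := by
  have hne : i₁ ≠ i₀ := fun h => by rw [h, h0] at h1; omega
  rw [secular_eq_sum, ← Finset.add_sum_erase univ _ (Finset.mem_univ i₀),
    ← Finset.add_sum_erase (univ.erase i₀) _ (Finset.mem_erase.2 ⟨hne, Finset.mem_univ i₁⟩),
    clearedSecular, h0, h1, mul_zero, alphaVal_zero, mul_one, sub_zero]
  have hneg : ∑ l ∈ (univ.erase i₀).erase i₁,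
        cycleWeight n l / (alphaVal n (2 * l) - x) * poleCoeff n m w δ₀ δ l x
      = -∑ l ∈ (univ.erase i₀).erase i₁,
        cycleWeight n l / (x - alphaVal n (2 * l)) * poleCoeff n m w δ₀ δ l x := by
    rw [← Finset.sum_neg_distrib]
    refine Finset.sum_congr rfl fun l _ => ?_
    rw [← neg_sub x, div_neg, neg_mul]
  -- The pole at `0` is removable: `weightCos` at frequency `0` is the total weight, so `δ * hubQuad
  -- - (δ - δ₀ * x) * ∑ w` is divisible by `x`.
  have hzero : cycleWeight n i₀ / x * poleCoeff n m w δ₀ δ 0 x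
      = -(cycleWeight n i₀ * (δ * (m + ∑ i, w i - x) - δ₀ * ∑ i, w i)
        / hubQuad m (∑ i, w i) x) := by
    rw [poleCoeff, weightCos_zero]
    field_simp
    rw [hubQuad]
    ring
  rw [hneg, hzero]
  have := sub_ne_zero.2 hx1
  have h3 : (alphaVal n 2 - x) * (cycleWeight n i₁ / (x - alphaVal n 2) * poleCoeff n m w δ₀ δ 1 x)
      = -(cycleWeight n i₁ * poleCoeff n m w δ₀ δ 1 x) := by
    field_simp
    ring
  linear_combination h3

/-- If `gapSign` is negative, the modified network has an eigenvalue in `(0, α₂)`. -/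
lemma exists_root_of_gapSign_neg {n m : ℕ} (hn : 3 ≤ n) (hm : 2 ≤ m) {w : Fin n → ℝ}
    (hw : ∀ i, 0 ≤ w i) (hwpos : 0 < ∑ i, w i) (hβ : alphaVal n 2 < betaMinus m (∑ i, w i))
    {δ₀ δ : ℝ} (hδ₀ : 0 ≤ δ₀) (hδ : δ₀ ≤ δ) (hS : gapSign m n w δ₀ δ < 0) :
    ∃ x, 0 < x ∧ x < alphaVal n 2 ∧ (secularPoly n m w δ₀ δ).eval x = 0 := by
  have hm' : (2 : ℝ) ≤ m := by exact_mod_cast hm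
  have hα := alphaVal_lt_alphaVal (n := n) (k := 0) (l := 2) (by omega) (by omega)
  rw [alphaVal_zero] at hα
  have hp : betaMinus m (∑ i, w i) < betaPlus m (∑ i, w i) := by
    linarith [betaMinus_lt_one hm (∑ i, w i), betaPlus_gt hm hwpos]
  have hq : ∀ x, x ≤ alphaVal n 2 → 0 < hubQuad m (∑ i, w i) x := by
    intro x hx
    rw [hubQuad_eq (by omega)]
    exact mul_pos_of_neg_of_neg (by linarith) (by linarith)
  set i₀ : Fin (n / 2 + 1) := ⟨0, by omega⟩ with hi₀
  set i₁ : Fin (n / 2 + 1) := ⟨1, by omega⟩ with hi₁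
  have hl : ∀ l ∈ (univ.erase i₀).erase i₁, alphaVal n 2 < alphaVal n (2 * l) := by
    intro l hl
    simp only [Finset.mem_erase, Finset.mem_univ, and_true, hi₀, hi₁, ne_eq, Fin.ext_iff] at hl
    have := l.2
    exact alphaVal_lt_alphaVal (by omega) (by omega)
  have hpole : ∀ l : ℕ, ContinuousOn (poleCoeff n m w δ₀ δ l) (Set.Icc 0 (alphaVal n 2)) := by
    intro l
    unfold poleCoeff
    have : ContinuousOn (fun x => (δ - δ₀ * x) / hubQuad m (∑ i, w i) x)
        (Set.Icc 0 (alphaVal n 2)) :=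
      ContinuousOn.div (by fun_prop) (by unfold hubQuad; fun_prop) fun x hx => (hq x hx.2).ne'
    fun_prop
  have hcont : ContinuousOn (clearedSecular n m w δ₀ δ i₀ i₁) (Set.Icc 0 (alphaVal n 2)) := by
    unfold clearedSecular
    refine ContinuousOn.add (ContinuousOn.mul (by fun_prop)
      (ContinuousOn.add (ContinuousOn.add continuousOn_const ?_) ?_))
      (ContinuousOn.mul continuousOn_const (hpole 1))
    · exact ContinuousOn.div (by fun_prop) (by unfold hubQuad; fun_prop) fun x hx => (hq x hx.2).ne'
    · refine continuousOn_finsetSum _ fun l hl' => ContinuousOn.mul ?_ (hpole l)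
      refine ContinuousOn.div (by fun_prop) (by fun_prop) fun x hx => ?_
      have := hl l hl'
      linarith [hx.2]
  have hpole0 : ∀ l, 0 ≤ poleCoeff n m w δ₀ δ l 0 := by
    intro l
    have h0 : hubQuad m (∑ i, w i) 0 = ∑ i, w i := by simp [hubQuad]
    rw [poleCoeff, h0, mul_zero, sub_zero, sub_nonneg, div_mul_eq_mul_div, div_le_iff₀ hwpos]
    exact mul_le_mul_of_nonneg_left (weightCos_le hw l) (hδ₀.trans hδ)
  have hzero : 0 < clearedSecular n m w δ₀ δ i₀ i₁ 0 := by
    unfold clearedSecular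
    have h1 : 0 ≤ cycleWeight n i₀ * (δ * (m + ∑ i, w i - 0) - δ₀ * ∑ i, w i)
        / hubQuad m (∑ i, w i) 0 := by
      refine div_nonneg (mul_nonneg (cycleWeight_pos hn _).le ?_) (hq 0 hα.le).le
      -- The expression equals `δ * m + (δ - δ₀) * ∑ w`.
      nlinarith [mul_le_mul_of_nonneg_right hδ hwpos.le]
    have h2 : 0 ≤ ∑ l ∈ (univ.erase i₀).erase i₁,
        cycleWeight n l / (alphaVal n (2 * l) - 0) * poleCoeff n m w δ₀ δ l 0 := by
      refine Finset.sum_nonneg fun l hl' => mul_nonneg (div_nonneg (cycleWeight_pos hn _).le ?_)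
        (hpole0 l)
      linarith [hl l hl']
    have h3 := mul_nonneg (cycleWeight_pos hn i₁).le (hpole0 1)
    exact add_pos_of_pos_of_nonneg (mul_pos (by rwa [sub_zero]) (by linarith)) h3
  have hS' : poleCoeff n m w δ₀ δ 1 (alphaVal n 2) = gapSign m n w δ₀ δ := by
    unfold poleCoeff gapSign weightCos
    rw [hubQuad]
    congr 3
    ext i
    congr 2
    push_cast
    ring
  have hone : clearedSecular n m w δ₀ δ i₀ i₁ (alphaVal n 2) < 0 := by
    unfold clearedSecular
    rw [sub_self, zero_mul, zero_add, hS']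
    exact mul_neg_of_pos_of_neg (cycleWeight_pos hn _) hS
  obtain ⟨x, ⟨hx0, hx1⟩, hx⟩ := intermediate_value_Ioo' hα.le hcont ⟨hone, hzero⟩
  refine ⟨x, hx0, hx1, ?_⟩
  have hqx := (hq x hx1.le).ne'
  rw [clearedSecular_eq rfl rfl hx0.ne' hx1.ne hqx] at hx
  have hsec := (mul_eq_zero.1 hx).resolve_left (by linarith)
  have hxl : ∀ l : Fin (n / 2 + 1), x ≠ alphaVal n (2 * l) := by
    intro l
    by_cases h0 : l = i₀
    · rw [h0, hi₀, mul_zero, alphaVal_zero]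
      exact hx0.ne'
    by_cases h1 : l = i₁
    · rw [h1, hi₁, mul_one]
      exact hx1.ne
    · exact (hx1.trans (hl l (by simp [h0, h1]))).ne
  rw [eval_secularPoly_of_ne w _ _ hxl hqx, hsec, mul_zero]

/-! ### The angle `θ` and the cosine sum -/

/-- The angle attached to a value of the unperturbed second eigenvalue below `α₂`. -/
lemma thetaOf_spec {x : ℝ} (h0 : 0 < x) (h4 : x ≤ 4) :
    x = 2 * (1 - Real.cos (thetaOf x)) ∧ 0 < thetaOf x := by
  have hc : Real.cos (thetaOf x) = -((x - 2) / 2) := by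
    rw [thetaOf, Real.cos_pi_sub, Real.cos_arccos (by linarith) (by linarith)]
  refine ⟨by rw [hc]; ring, ?_⟩
  have hnn : 0 ≤ thetaOf x := sub_nonneg.2 (Real.arccos_le_pi _)
  refine lt_of_le_of_ne hnn fun h => ?_
  rw [← h, Real.cos_zero] at hc
  linarith

lemma thetaOf_lt {n l : ℕ} {x : ℝ} (hn : 0 < n) (h0 : 0 < x) (h : x < alphaVal n l) :
    thetaOf x < l * Real.pi / n := by
  have h4 := h.le.trans (alphaVal_le_four n l)
  have hn' : (0 : ℝ) < n := by exact_mod_cast hn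
  by_contra! hle
  have hpi : thetaOf x ≤ Real.pi := by
    rw [thetaOf]
    linarith [Real.arccos_nonneg ((x - 2) / 2)]
  have hcos := Real.cos_le_cos_of_nonneg_of_le_pi (by positivity) hpi hle
  have := (thetaOf_spec h0 h4).1
  rw [alphaVal] at h
  linarith

/-- Below `α₂` the angle lies in `(0, 2π / n)`, so `θ` and `n θ / 2` both lie in `(0, π)`. This
makes the denominator in the closed form of the Green function positive. -/
lemma sin_mul_sin_thetaOf_pos {n : ℕ} (hn : 3 ≤ n) {x : ℝ} (h0 : 0 < x) (h : x < alphaVal n 2) :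
    0 < Real.sin (thetaOf x) * Real.sin (n / 2 * thetaOf x) := by
  have hθ := (thetaOf_spec h0 (h.le.trans (alphaVal_le_four n 2))).2
  have hlt := thetaOf_lt (by omega) h0 h
  have hn' : (3 : ℝ) ≤ n := by exact_mod_cast hn
  have hn0 : (0 : ℝ) < n := by linarith
  rw [lt_div_iff₀ hn0] at hlt
  push_cast at hlt
  refine mul_pos (Real.sin_pos_of_pos_of_lt_pi hθ ?_)
    (Real.sin_pos_of_pos_of_lt_pi (by positivity) (by linarith))
  nlinarith

/-- Below `α₁` the angle is less than `π / n`, so every `(n / 2 - i) θ` lies strictly within `π / 2`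
of `0`. -/
lemma cosineSum_pos {n : ℕ} (hn : 3 ≤ n) {w : Fin n → ℝ} (hw : ∀ i, 0 ≤ w i)
    (hwpos : 0 < ∑ i, w i) {x : ℝ} (h0 : 0 < x) (h : x < alphaVal n 1) :
    0 < cosineSum n w (thetaOf x) := by
  have hθ := (thetaOf_spec h0 (h.le.trans (alphaVal_le_four n 1))).2
  have hlt := thetaOf_lt (by omega) h0 h
  have hn0 : (0 : ℝ) < n := by
    have : 0 < n := by omega
    exact_mod_cast this
  rw [lt_div_iff₀ hn0] at hlt
  push_cast at hlt
  have hcos : ∀ i : Fin n, 0 < Real.cos (((n : ℝ) / 2 - ((i : ℕ) : ℝ)) * thetaOf x) := by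
    intro i
    have hi : ((i : ℕ) : ℝ) ≤ n := by exact_mod_cast i.2.le
    have hi0 : (0 : ℝ) ≤ ((i : ℕ) : ℝ) := by positivity
    refine Real.cos_pos_of_mem_Ioo ⟨?_, ?_⟩ <;> nlinarith
  obtain ⟨i, -, hi⟩ := Finset.exists_lt_of_sum_lt
    (show ∑ i : Fin n, (0 : ℝ) < ∑ i, w i by simpa using hwpos)
  exact Finset.sum_pos' (fun i _ => mul_nonneg (hw i) (hcos i).le)
    ⟨i, Finset.mem_univ i, mul_pos hi (hcos i)⟩

/-! ### Comparison of the second eigenvalues -/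

section Main

variable {n k : ℕ} {w : Fin n → ℝ} {s : Fin (n / 2 + 1) ⊕ Fin 2 → ℝ} {η : ℝ}

lemma secularPoly_base (hk : 3 ≤ k) (w : Fin n → ℝ) :
    secularPoly n (k + 1) w ((0 : Fin (k + 1) → ℝ) 0) (∑ j, (0 : Fin (k + 1) → ℝ) j)
      = ∏ i, (Polynomial.X - Polynomial.C (baseRoots n (k + 1) (∑ i, w i) i)) := by
  simp only [Pi.zero_apply, Finset.sum_const_zero]
  exact secularPoly_zero_zero (by omega) w

lemma alphaVal_two_le_fin (l : Fin (n / 2 + 1)) (hn : 3 ≤ n) (hl : l ≠ 0) :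
    alphaVal n 2 ≤ alphaVal n (2 * l) :=
  alphaVal_two_le (by have := l.2; omega) (fun h => hl (Fin.ext h))

/-- Base roots are at least `2 η` apart and each moves by less than `η`, so no root can jump over
another base root. -/
lemma lt_of_baseRoots_lt {ι : Type*} {r s : ι → ℝ}
    (hη : 0 < η) (hsep : ∀ i j, i ≠ j → 2 * η ≤ |r i - r j|) (hs : ∀ i, |s i - r i| < η) {i j : ι}
    (h : r i < r j) : r i < s j := by
  have h1 := hsep j i (fun e => by rw [e] at h; exact h.false)
  rw [abs_of_pos (sub_pos.2 h)] at h1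
  linarith [(abs_lt.1 (hs j)).1]

/-- The root near `0` does not move. -/
lemma root_zero_eq_zero {δ₀ δ : ℝ} (hη : 0 < η)
    (hsep : ∀ i j, i ≠ j →
      2 * η ≤ |baseRoots n (k + 1) (∑ i, w i) i - baseRoots n (k + 1) (∑ i, w i) j|)
    (hs : ∀ i, |s i - baseRoots n (k + 1) (∑ i, w i) i| < η)
    (hp : secularPoly n (k + 1) w δ₀ δ = ∏ i, (Polynomial.X - Polynomial.C (s i))) :
    s (Sum.inl 0) = 0 := by
  have h := eval_secularPoly_zero n (k + 1) w δ₀ δ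
  rw [hp, Polynomial.eval_prod] at h
  obtain ⟨i, -, hi⟩ := Finset.prod_eq_zero_iff.1 h
  have hi0 : s i = 0 := by simpa using hi
  by_cases hne : i = Sum.inl 0
  · rw [← hne, hi0]
  · have h1 := hsep i (Sum.inl 0) hne
    have h2 := hs i
    have h3 : baseRoots n (k + 1) (∑ i, w i) (Sum.inl 0) = 0 := by simp [baseRoots, alphaVal_zero]
    rw [h3, sub_zero] at h1
    rw [hi0, zero_sub, abs_neg] at h2
    linarith

/-- The unperturbed second eigenvalue when `β⁻` lies above `α₂`. -/
lemma alphaVal_two_le_reLambda2_base (hn : 3 ≤ n) (hk : 3 ≤ k) (hwpos : 0 < ∑ i, w i)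
    (hβ : alphaVal n 2 < betaMinus (k + 1) (∑ i, w i)) :
    alphaVal n 2 ≤ reLambda2 (cycleStarLaplacian n (k + 1) w 0) := by
  have h1 := betaMinus_lt_one (m := k + 1) (by omega) (∑ i, w i)
  have hp := betaPlus_gt (m := k + 1) (by omega) hwpos
  have hm : (1 : ℝ) ≤ ((k + 1 : ℕ) : ℝ) := by exact_mod_cast (by omega : 1 ≤ k + 1)
  refine reLambda2_cycleStarLaplacian_induction (P := fun x => alphaVal n 2 ≤ x) hn (by omega)
    (secularPoly_base hk w) (by simp [baseRoots, alphaVal_zero]) ?_ (by linarith)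
    (fun l hl hl0 => alphaVal_two_le hl hl0) (fun x hx => (alphaVal_two_pos hn).le.trans hx)
  rintro (l | j) hi
  · exact alphaVal_two_le_fin l hn (fun h => hi (by rw [h]))
  · fin_cases j
    · exact hβ.le
    · change alphaVal n 2 ≤ betaPlus (k + 1) (∑ i, w i)
      linarith

/-- The unperturbed second eigenvalue when `β⁻` lies below `α₂`. -/
lemma betaMinus_le_reLambda2_base (hn : 3 ≤ n) (hk : 3 ≤ k) (hwpos : 0 < ∑ i, w i)
    (hβ : betaMinus (k + 1) (∑ i, w i) < alphaVal n 2) :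
    betaMinus (k + 1) (∑ i, w i) ≤ reLambda2 (cycleStarLaplacian n (k + 1) w 0) := by
  have h0 := betaMinus_pos (m := k + 1) (by omega) hwpos
  have h1 := betaMinus_lt_one (m := k + 1) (by omega) (∑ i, w i)
  have hp := betaPlus_gt (m := k + 1) (by omega) hwpos
  have hm : (1 : ℝ) ≤ ((k + 1 : ℕ) : ℝ) := by exact_mod_cast (by omega : 1 ≤ k + 1)
  refine reLambda2_cycleStarLaplacian_induction (P := fun x => betaMinus (k + 1) (∑ i, w i) ≤ x)
    hn (by omega) (secularPoly_base hk w) (by simp [baseRoots, alphaVal_zero]) ?_ h1.le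
    (fun l hl hl0 => hβ.le.trans (alphaVal_two_le hl hl0)) (fun x hx => h0.le.trans hx)
  rintro (l | j) hi
  · exact hβ.le.trans (alphaVal_two_le_fin l hn (fun h => hi (by rw [h])))
  · fin_cases j
    · exact le_rfl
    · change betaMinus (k + 1) (∑ i, w i) ≤ betaPlus (k + 1) (∑ i, w i)
      linarith

lemma reLambda2_base_le_betaMinus (hn : 3 ≤ n) (hk : 3 ≤ k) (hwpos : 0 < ∑ i, w i) :
    reLambda2 (cycleStarLaplacian n (k + 1) w 0) ≤ betaMinus (k + 1) (∑ i, w i) := by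
  have h0 := betaMinus_pos (m := k + 1) (by omega) hwpos
  refine reLambda2_le_of_roots (eval_charpoly_zero hn (by omega) w 0)
    (eval_charpoly_of_eval_secularPoly hn (by omega) ?_) h0.ne h0.le le_rfl
  rw [secularPoly_base hk w, Polynomial.eval_prod]
  exact Finset.prod_eq_zero (Finset.mem_univ (Sum.inr 0)) (by simp [baseRoots])

/-- The root near `α₂` moves to the right if `gapSign` is positive. -/
lemma alphaVal_two_lt_root (hn : 3 ≤ n) (hk : 3 ≤ k) {δ₀ δ : ℝ}
    (hsep : ∀ i j, i ≠ j →
      2 * η ≤ |baseRoots n (k + 1) (∑ i, w i) i - baseRoots n (k + 1) (∑ i, w i) j|)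
    (hs : ∀ i, |s i - baseRoots n (k + 1) (∑ i, w i) i| < η)
    (hp : secularPoly n (k + 1) w δ₀ δ = ∏ i, (Polynomial.X - Polynomial.C (s i)))
    (hq : hubQuad (k + 1) (∑ i, w i) (alphaVal n 2) ≠ 0) (hS : 0 < gapSign (k + 1) n w δ₀ δ) :
    alphaVal n 2 < s (Sum.inl ⟨1, by omega⟩) := by
  set i₁ : Fin (n / 2 + 1) := ⟨1, by omega⟩ with hi₁
  have hr : baseRoots n (k + 1) (∑ i, w i) (Sum.inl i₁) = alphaVal n 2 := by
    simp [baseRoots, hi₁]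
  have h := eval_secularPoly_alphaVal_two (m := k + 1) hn w δ₀ δ hq
  rw [hp, Polynomial.eval_prod] at h
  simp only [Polynomial.eval_sub, Polynomial.eval_X, Polynomial.eval_C] at h
  rw [← hr]
  refine (root_side hsep hs (Sum.inl i₁)
    (c := cycleWeight n i₁ * gapSign (k + 1) n w δ₀ δ) ?_).1 (mul_pos (cycleWeight_pos hn _) hS)
  rw [hr, h, prod_erase_inl, Fin.prod_univ_two, hubQuad_eq (by omega)]
  simp only [baseRoots, Sum.elim_inl, Sum.elim_inr, Matrix.cons_val_zero, Matrix.cons_val_one]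
  ring

/-- The root near `β⁻` moves according to the sign of `cosineSum`. -/
lemma betaMinus_root_side (hn : 3 ≤ n) (hk : 3 ≤ k) (hwpos : 0 < ∑ i, w i) {δ₀ δ : ℝ}
    (hδ : 0 < δ - δ₀ * betaMinus (k + 1) (∑ i, w i))
    (hsep : ∀ i j, i ≠ j →
      2 * η ≤ |baseRoots n (k + 1) (∑ i, w i) i - baseRoots n (k + 1) (∑ i, w i) j|)
    (hs : ∀ i, |s i - baseRoots n (k + 1) (∑ i, w i) i| < η)
    (hp : secularPoly n (k + 1) w δ₀ δ = ∏ i, (Polynomial.X - Polynomial.C (s i)))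
    (hβ : ∀ l : ℕ, l ≤ n → betaMinus (k + 1) (∑ i, w i) ≠ alphaVal n l)
    (hlt : betaMinus (k + 1) (∑ i, w i) < alphaVal n 2) :
    (0 < cosineSum n w (thetaOf (betaMinus (k + 1) (∑ i, w i))) →
      betaMinus (k + 1) (∑ i, w i) < s (Sum.inr 0)) ∧
    (cosineSum n w (thetaOf (betaMinus (k + 1) (∑ i, w i))) < 0 →
      s (Sum.inr 0) < betaMinus (k + 1) (∑ i, w i)) := by
  set b := betaMinus (k + 1) (∑ i, w i) with hb
  set c := betaPlus (k + 1) (∑ i, w i) with hc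
  have h0 : 0 < b := betaMinus_pos (m := k + 1) (by omega) hwpos
  have h1 : b < 1 := betaMinus_lt_one (m := k + 1) (by omega) (∑ i, w i)
  have hpl : ((k + 1 : ℕ) : ℝ) < c := betaPlus_gt (m := k + 1) (by omega) hwpos
  have hm : (1 : ℝ) ≤ ((k + 1 : ℕ) : ℝ) := by exact_mod_cast (by omega : 1 ≤ k + 1)
  have hbc : 0 < c - b := by linarith
  have hsin := sin_mul_sin_thetaOf_pos hn h0 hlt
  have hxl : ∀ l : Fin (n / 2 + 1), b ≠ alphaVal n (2 * l) := fun l =>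
    hβ _ (by have := l.2; omega)
  have hq0 : hubQuad (k + 1) (∑ i, w i) b = 0 := by
    rw [hubQuad_eq (by omega), ← hb, sub_self, zero_mul]
  have heval : (secularPoly n (k + 1) w δ₀ δ).eval b
      = (δ - δ₀ * b) * ((cycleDistinctPoly n).eval b
        * (cosineSum n w (thetaOf b) / (2 * (Real.sin (thetaOf b) * Real.sin (n / 2 * thetaOf b))))) := by
    have hsum : ∑ i : Fin n, w i * (greenPoly n i).eval b = (cycleDistinctPoly n).eval b
        * (cosineSum n w (thetaOf b)
          / (2 * (Real.sin (thetaOf b) * Real.sin (n / 2 * thetaOf b)))) := by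
      rw [cosineSum, Finset.sum_div, Finset.mul_sum]
      refine Finset.sum_congr rfl fun i _ => ?_
      rw [eval_greenPoly_coe i hxl, cycleGreen_eq_cos hn hxl
        (thetaOf_spec h0 (by linarith)).1 hsin.ne']
      ring
    rw [eval_secularPoly, hq0, hsum]
    ring
  -- The division by `β⁺ - β⁻ > 0` absorbs the factor `β⁻ - β⁺` in the product over the other base
  -- roots, including its sign.
  have key := root_side hsep hs (Sum.inr 0)
    (c := (δ - δ₀ * b) * (cosineSum n w (thetaOf b)
      / (2 * (Real.sin (thetaOf b) * Real.sin (n / 2 * thetaOf b)))) / (c - b)) (by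
        have hr : baseRoots n (k + 1) (∑ i, w i) (Sum.inr 0) = b := by simp [baseRoots, hb]
        rw [hp, Polynomial.eval_prod] at heval
        simp only [Polynomial.eval_sub, Polynomial.eval_X, Polynomial.eval_C] at heval
        have herase : (univ.erase (0 : Fin 2)) = {1} := by decide
        rw [hr, heval, prod_erase_inr, herase, Finset.prod_singleton, eval_cycleDistinctPoly]
        simp only [baseRoots, Sum.elim_inl, Sum.elim_inr, Matrix.cons_val_one,
          Matrix.cons_val_fin_one]
        rw [← hc]
        generalize cosineSum n w (thetaOf b)
          / (2 * (Real.sin (thetaOf b) * Real.sin (n / 2 * thetaOf b))) = y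
        generalize ∏ l : Fin (n / 2 + 1), (b - alphaVal n (2 * l)) = z
        field_simp
        ring)
  have hr : baseRoots n (k + 1) (∑ i, w i) (Sum.inr 0) = b := by simp [baseRoots, hb]
  rw [hr] at key
  refine ⟨fun h => key.1 (by positivity), fun h => key.2 ?_⟩
  exact div_neg_of_neg_of_pos (mul_neg_of_pos_of_neg hδ
    (div_neg_of_neg_of_pos h (by positivity))) hbc

/-- `d 0` is one of the summands and `b < 1`. With `b = β⁻` this fixes the sign of the prefactor in
the value of `secularPoly` at `β⁻`. -/
lemma sub_mul_betaMinus_pos {b : ℝ} (hb : b < 1) {d : Fin (k + 1) → ℝ} (hd : ∀ j, 0 ≤ d j)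
    (hd0 : d ≠ 0) : 0 < (∑ j, d j) - d 0 * b := by
  have hle : d 0 ≤ ∑ j, d j := Finset.single_le_sum (fun j _ => hd j) (Finset.mem_univ 0)
  have hpos : 0 < ∑ j, d j := by
    refine lt_of_le_of_ne (Finset.sum_nonneg fun j _ => hd j) fun h => hd0 ?_
    ext j
    exact (Finset.sum_eq_zero_iff_of_nonneg fun j _ => hd j).1 h.symm j (Finset.mem_univ j)
  rcases (hd 0).eq_or_lt with h | h
  · rw [← h]; linarith
  · nlinarith

end Main

/-- The main theorem for a star with `k` leaves. -/
theorem spectralGap_cycleStar_succ (n k : ℕ) (hn : 3 ≤ n) (hk : 3 ≤ k) (w : Fin n → ℝ) (hw : ∀ i, 0 ≤ w i)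
    (hβ : ∀ l : ℕ, l ≤ n → betaMinus (k + 1) (∑ i, w i) ≠ alphaVal n l) :
    HasRealSpectrum (cycleStarLaplacian n (k + 1) w 0) ∧
    (∃ ε : ℝ, 0 < ε ∧ ∀ d : Fin (k + 1) → ℝ, (∀ j, 0 ≤ d j) → d ≠ 0 → (∀ j, d j < ε) →
      HasRealSpectrum (cycleStarLaplacian n (k + 1) w d) ∧
      (alphaVal n 2 < betaMinus (k + 1) (∑ i, w i) →
        gapSign (k + 1) n w (d 0) (∑ j, d j) < 0 →
        reLambda2 (cycleStarLaplacian n (k + 1) w d)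
          < reLambda2 (cycleStarLaplacian n (k + 1) w 0)) ∧
      (alphaVal n 2 < betaMinus (k + 1) (∑ i, w i) →
        0 < gapSign (k + 1) n w (d 0) (∑ j, d j) →
        reLambda2 (cycleStarLaplacian n (k + 1) w d)
          = reLambda2 (cycleStarLaplacian n (k + 1) w 0)) ∧
      (0 < betaMinus (k + 1) (∑ i, w i) → betaMinus (k + 1) (∑ i, w i) < alphaVal n 1 →
        reLambda2 (cycleStarLaplacian n (k + 1) w 0)
          < reLambda2 (cycleStarLaplacian n (k + 1) w d)) ∧
      (alphaVal n 1 < betaMinus (k + 1) (∑ i, w i) → betaMinus (k + 1) (∑ i, w i) < alphaVal n 2 →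
        0 < cosineSum n w (thetaOf (betaMinus (k + 1) (∑ i, w i))) →
        reLambda2 (cycleStarLaplacian n (k + 1) w 0)
          < reLambda2 (cycleStarLaplacian n (k + 1) w d)) ∧
      (alphaVal n 1 < betaMinus (k + 1) (∑ i, w i) → betaMinus (k + 1) (∑ i, w i) < alphaVal n 2 →
        cosineSum n w (thetaOf (betaMinus (k + 1) (∑ i, w i))) < 0 →
        reLambda2 (cycleStarLaplacian n (k + 1) w d)
          < reLambda2 (cycleStarLaplacian n (k + 1) w 0))) ∧
    (alphaVal n 2 < betaMinus (k + 1) (∑ i, w i) →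
      ∀ d : Fin (k + 1) → ℝ, (∀ j, 0 ≤ d j) → d ≠ 0 →
      (gapSign (k + 1) n w (d 0) (∑ j, d j) < 0 →
        reLambda2 (cycleStarLaplacian n (k + 1) w d)
          < reLambda2 (cycleStarLaplacian n (k + 1) w 0)) ∧
      (0 < gapSign (k + 1) n w (d 0) (∑ j, d j) →
        reLambda2 (cycleStarLaplacian n (k + 1) w d)
          ≤ reLambda2 (cycleStarLaplacian n (k + 1) w 0))) := by
  -- Total weight zero would give `β⁻ = 0 = α₀`, which is excluded.
  have hwpos : 0 < ∑ i, w i := by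
    refine lt_of_le_of_ne (Finset.sum_nonneg fun i _ => hw i) fun h => hβ 0 (Nat.zero_le _) ?_
    rw [← h, betaMinus_zero, alphaVal_zero]
  have hk1 : 1 ≤ k := by omega
  have hb0 : 0 < betaMinus (k + 1) (∑ i, w i) := betaMinus_pos (by omega) hwpos
  have hb1 : betaMinus (k + 1) (∑ i, w i) < 1 := betaMinus_lt_one (by omega) _
  have hbp := betaPlus_gt (m := k + 1) (by omega) hwpos
  have hm : (1 : ℝ) ≤ ((k + 1 : ℕ) : ℝ) := by exact_mod_cast (by omega : 1 ≤ k + 1)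
  have hα2 := alphaVal_two_pos hn
  have h12 : alphaVal n 1 < alphaVal n 2 := alphaVal_lt_alphaVal (by omega) (by omega)
  have hglobal : alphaVal n 2 < betaMinus (k + 1) (∑ i, w i) →
      ∀ d : Fin (k + 1) → ℝ, (∀ j, 0 ≤ d j) → gapSign (k + 1) n w (d 0) (∑ j, d j) < 0 →
      reLambda2 (cycleStarLaplacian n (k + 1) w d)
        < reLambda2 (cycleStarLaplacian n (k + 1) w 0) := by
    intro hlt d hd hS
    obtain ⟨x, hx0, hx1, hx⟩ := exists_root_of_gapSign_neg hn (by omega) hw hwpos hlt (hd 0)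
      (Finset.single_le_sum (fun j _ => hd j) (Finset.mem_univ 0)) hS
    calc reLambda2 (cycleStarLaplacian n (k + 1) w d) ≤ x :=
          reLambda2_le_of_roots (eval_charpoly_zero hn hk1 w d)
            (eval_charpoly_of_eval_secularPoly hn hk1 hx) hx0.ne hx0.le le_rfl
      _ < alphaVal n 2 := hx1
      _ ≤ _ := alphaVal_two_le_reLambda2_base hn hk hwpos hlt
  refine ⟨hasRealSpectrum_cycleStarLaplacian hn hk1 (secularPoly_base hk w), ?_,
    fun hlt d hd _ => ⟨hglobal hlt d hd, fun _ =>
      (reLambda2_le_alphaVal_two hn hk1 w d).trans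
        (alphaVal_two_le_reLambda2_base hn hk hwpos hlt)⟩⟩
  obtain ⟨η, hη, hsep⟩ := exists_separation (baseRoots_injective (m := k + 1) (by omega) hwpos hβ)
  obtain ⟨ε, hε, hroots⟩ := exists_secularPoly_roots hk w hη hsep
  refine ⟨ε, hε, fun d hd hd0 hdε => ?_⟩
  obtain ⟨s, hs, hp⟩ := hroots d hd hdε
  have hs0 := root_zero_eq_zero hη hsep hs hp
  have hδ := sub_mul_betaMinus_pos hb1 hd hd0
  have hright : betaMinus (k + 1) (∑ i, w i) < alphaVal n 2 →
      0 < cosineSum n w (thetaOf (betaMinus (k + 1) (∑ i, w i))) →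
      reLambda2 (cycleStarLaplacian n (k + 1) w 0)
        < reLambda2 (cycleStarLaplacian n (k + 1) w d) := by
    intro hlt hcos
    refine (reLambda2_base_le_betaMinus hn hk hwpos).trans_lt ?_
    refine reLambda2_cycleStarLaplacian_induction (P := fun x => betaMinus (k + 1) (∑ i, w i) < x)
      hn hk1 hp hs0 ?_ hb1 (fun l hl hl0 => hlt.trans_le (alphaVal_two_le hl hl0))
      (fun x hx => (hb0.trans hx).le)
    rintro (l | j) hi
    · exact lt_of_baseRoots_lt (i := Sum.inr 0) hη hsep hs
        (hlt.trans_le (alphaVal_two_le_fin l hn (fun h => hi (by rw [h]))))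
    · fin_cases j
      · exact (betaMinus_root_side hn hk hwpos hδ hsep hs hp hβ hlt).1 hcos
      · refine lt_of_baseRoots_lt (i := Sum.inr 0) hη hsep hs ?_
        change betaMinus (k + 1) (∑ i, w i) < betaPlus (k + 1) (∑ i, w i)
        linarith
  refine ⟨hasRealSpectrum_cycleStarLaplacian hn hk1 hp, fun hlt => hglobal hlt d hd, ?_,
    fun _ hlt => hright (hlt.trans h12) (cosineSum_pos hn hw hwpos hb0 hlt),
    fun _ hlt => hright hlt, ?_⟩
  · intro hlt hS
    refine le_antisymm ((reLambda2_le_alphaVal_two hn hk1 w d).trans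
      (alphaVal_two_le_reLambda2_base hn hk hwpos hlt))
      ((reLambda2_le_alphaVal_two hn hk1 w 0).trans ?_)
    refine reLambda2_cycleStarLaplacian_induction (P := fun x => alphaVal n 2 ≤ x)
      hn hk1 hp hs0 ?_ (by linarith) (fun l hl hl0 => alphaVal_two_le hl hl0)
      (fun x hx => hα2.le.trans hx)
    have hr : baseRoots n (k + 1) (∑ i, w i) (Sum.inl ⟨1, by omega⟩) = alphaVal n 2 := by
      simp [baseRoots]
    -- Only the root starting at `α₂` could cross it, and it moves right since `S > 0`; the others
    -- start strictly above and cannot reach it.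
    rintro (l | j) hi
    · by_cases h1 : l = ⟨1, by omega⟩
      · have hq : hubQuad (k + 1) (∑ i, w i) (alphaVal n 2) ≠ 0 := by
          rw [hubQuad_eq (by omega)]
          exact (mul_pos_of_neg_of_neg (by linarith) (by linarith)).ne'
        rw [h1]
        exact (alphaVal_two_lt_root hn hk hsep hs hp hq hS).le
      · rw [← hr]
        refine (lt_of_baseRoots_lt hη hsep hs ?_).le
        rw [hr]
        refine lt_of_le_of_ne (alphaVal_two_le_fin l hn (fun h => hi (by rw [h]))) fun h => h1 ?_
        exact alphaVal_two_mul_injective n h.symm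
    · rw [← hr]
      refine (lt_of_baseRoots_lt hη hsep hs ?_).le
      rw [hr]
      fin_cases j
      · exact hlt
      · change alphaVal n 2 < betaPlus (k + 1) (∑ i, w i)
        linarith
  · intro _ hlt hcos
    refine lt_of_lt_of_le ?_ (betaMinus_le_reLambda2_base hn hk hwpos hlt)
    have hside := (betaMinus_root_side hn hk hwpos hδ hsep hs hp hβ hlt).2 hcos
    -- Positivity separates this root from the eigenvalue `0`, so two distinct eigenvalues bound
    -- `λ₂`.
    have hspos : 0 < s (Sum.inr 0) := by
      have h0 : baseRoots n (k + 1) (∑ i, w i) (Sum.inl 0) = 0 := by simp [baseRoots, alphaVal_zero]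
      rw [← h0]
      refine lt_of_baseRoots_lt hη hsep hs ?_
      rw [h0]
      exact hb0
    refine (reLambda2_le_of_roots (eval_charpoly_zero hn hk1 w d)
      (eval_charpoly_of_eval_secularPoly hn hk1 ?_) hspos.ne hspos.le le_rfl).trans_lt hside
    rw [hp, Polynomial.eval_prod]
    exact Finset.prod_eq_zero (Finset.mem_univ (Sum.inr 0)) (by simp)

end

theorem theoremC (n m : ℕ) (hn : 3 ≤ n) (hm : 4 ≤ m) (w : Fin n → ℝ) (hw : ∀ i, 0 ≤ w i)
    (hβ : ∀ l : ℕ, l ≤ n → betaMinus m (∑ i, w i) ≠ alphaVal n l) :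
    HasRealSpectrum (cycleStarLaplacian n m w 0) ∧
    (∃ ε : ℝ, 0 < ε ∧ ∀ d : Fin m → ℝ, (∀ j, 0 ≤ d j) → d ≠ 0 → (∀ j, d j < ε) →
      HasRealSpectrum (cycleStarLaplacian n m w d) ∧
      (alphaVal n 2 < betaMinus m (∑ i, w i) →
        gapSign m n w (d ⟨0, by omega⟩) (∑ j, d j) < 0 →
        reLambda2 (cycleStarLaplacian n m w d) < reLambda2 (cycleStarLaplacian n m w 0)) ∧
      (alphaVal n 2 < betaMinus m (∑ i, w i) →
        0 < gapSign m n w (d ⟨0, by omega⟩) (∑ j, d j) →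
        reLambda2 (cycleStarLaplacian n m w d) = reLambda2 (cycleStarLaplacian n m w 0)) ∧
      (0 < betaMinus m (∑ i, w i) → betaMinus m (∑ i, w i) < alphaVal n 1 →
        reLambda2 (cycleStarLaplacian n m w 0) < reLambda2 (cycleStarLaplacian n m w d)) ∧
      (alphaVal n 1 < betaMinus m (∑ i, w i) → betaMinus m (∑ i, w i) < alphaVal n 2 →
        0 < cosineSum n w (thetaOf (betaMinus m (∑ i, w i))) →
        reLambda2 (cycleStarLaplacian n m w 0) < reLambda2 (cycleStarLaplacian n m w d)) ∧
      (alphaVal n 1 < betaMinus m (∑ i, w i) → betaMinus m (∑ i, w i) < alphaVal n 2 →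
        cosineSum n w (thetaOf (betaMinus m (∑ i, w i))) < 0 →
        reLambda2 (cycleStarLaplacian n m w d) < reLambda2 (cycleStarLaplacian n m w 0))) ∧
    (alphaVal n 2 < betaMinus m (∑ i, w i) →
      ∀ d : Fin m → ℝ, (∀ j, 0 ≤ d j) → d ≠ 0 →
      (gapSign m n w (d ⟨0, by omega⟩) (∑ j, d j) < 0 →
        reLambda2 (cycleStarLaplacian n m w d) < reLambda2 (cycleStarLaplacian n m w 0)) ∧
      (0 < gapSign m n w (d ⟨0, by omega⟩) (∑ j, d j) →
        reLambda2 (cycleStarLaplacian n m w d) ≤ reLambda2 (cycleStarLaplacian n m w 0))) := by 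
  obtain ⟨k, rfl⟩ : ∃ k, m = k + 1 := ⟨m - 1, by omega⟩
  exact spectralGap_cycleStar_succ n k hn (by omega) w hw hβ
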